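/- **Setting.** Consider the feedback loop $e=r-\mathcal C_4y$, $z=\mathcal C_1e$, $v=\mathcal C_r z+\mathcal C_2z$, $u=\mathcal C_3v$, $y=\mathcal Pu$, $z_s=\mathcal C_sz$, where $\mathcal C_1,\mathcal C_2,\mathcal C_3,\mathcal C_4,\mathcal C_s,\mathcal P$ are finite-dimensional real SISO LTI systems (proper transfer functions) and $\mathcal C_r$ is the reset controller $\dot x_r=A_Rx_r+B_Rz$ for $t\notin J$, $x_r(t^+)=A_\rho x_r(t)$ for $t\in J$, $m=C_Rx_r+D_Rz$, with $A_\rho=\mathrm{diag}(\gamma,1,\dots,1)$, $\gamma\in(-1,1]$, and zero-crossing law $J=\{t: z_s(t)=0\}$. There is no direct feedthrough around the loop (the product of the feedthrough gains of $\mathcal C_1,\mathcal C_3,\mathcal P,\mathcal C_4$ is $0$; e.g. the plant is strictly proper). Assume the $H_\beta$ condition: the base-linear closed loop (no resets), with system matrix $A_{cl}$, is Hurwitz, and there are $\beta\in\mathbb R$ and $p>0$ such that $[\beta c_{z_s}+pB_0^{T}](sI-A_{cl})^{-1}B_0$ is strictly positive real, where $B_0$ is the unit vector of the reset state (the first state of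 $\mathcal C_r$) and $c_{z_s}$ is the row expressing $z_s$ through the closed-loop state. Let $r(t)=|R|\sin\omega t$ with $|R|>0$, $\omega>0$, and consider any $2\pi/\omega$-periodic steady-state response. For a signal $f$ write its $n$th harmonic as $|F^n|\sin(n\omega t+\angle F^n)$, $F^n=|F^n|e^{j\angle F^n}$. Two-reset assumption: $Z_s^1\neq0$ and $z_s$ vanishes exactly at the zeros of its first harmonic $z_s^1(t)=|Z_s^1|\sin(\omega t+\angle Z_s^1)$ (in particular this holds if $z_s=z_s^1\ne 0$), so that $J=\{(\eta\pi-\angle Z_s^1)/\omega\}$. **Notation.** For an LTI block write $\mathcal C(n\omega)$ for its transfer function at $jn\omega$; $\mathcal C_l(n\omega)=C_R(jn\omega I-A_R)^{-1}B_R+D_R$. Put $\Delta_l(n\omega)=(jn\omega I-A_R)^{-1}B_R$, $\Delta_x(n\omega)=C_R(jn\omega I-A_R)^{-1}jn\omega$, $\Delta_c(\omega)=|\Delta_l(\omega)|\sin(\angle\Delta_l(\omega)-\angle\mathcal C_s(\omega))$ (componentwise), $\Delta_q(\omega)=(I+e^{A_R\pi/\omega})(A_\rho e^{A_R\pi/\omega}+I)^{-1}(A_\rho-I)\Delta_c(\omega)$,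 $\mathcal C_\rho^n(\omega)=2\Delta_x(n\omega)\Delta_q(\omega)e^{jn\angle\mathcal C_s(\omega)}/(n\pi)$, $$\mathcal L_n(\omega)=\begin{cases}\mathcal C_1(\omega)[\mathcal C_l(\omega)+\mathcal C_\rho^1(\omega)+\mathcal C_2(\omega)]\mathcal C_3(\omega)\mathcal P(\omega),&n=1,\\ \mathcal C_1(\omega)e^{j(n-1)\angle\mathcal C_1(\omega)}\mathcal C_\rho^n(\omega)\mathcal C_3(n\omega)\mathcal P(n\omega),&n>1\text{ odd},\end{cases}$$ $\mathcal L_l(n\omega)=[\mathcal C_l(n\omega)+\mathcal C_2(n\omega)]\mathcal C_3(n\omega)\mathcal P(n\omega)\mathcal C_4(n\omega)\mathcal C_1(n\omega)$, $\mathcal L_\rho(n\omega)=\mathcal C_\rho^n(\omega)\mathcal C_3(n\omega)\mathcal P(n\omega)\mathcal C_4(n\omega)\mathcal C_1(n\omega)$, $\mathcal S_l(n\omega)=1/(1+\mathcal L_l(n\omega))$, $\Psi_n(\omega)=|\mathcal L_\rho(n\omega)|/|1+\mathcal L_l(n\omega)|$. Let $\Delta_c^1(\omega)$ be the reset-state (first)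 component of $\Delta_c(\omega)$ and, with $\Delta_{l,1}$ the first component of $\Delta_l$, let $\Delta_c^n(\omega)=-|\Delta_{l,1}(n\omega)|\sin(\angle\Delta_{l,1}(n\omega)+\angle\mathcal L_\rho(n\omega)-\angle(1+\mathcal L_l(n\omega))-n\angle\mathcal C_s(\omega))$ for $n>1$. Finally $$\Gamma(\omega)=\frac1{1-\sum_{n=3,5,7,\dots}\Psi_n(\omega)\Delta_c^n(\omega)/\Delta_c^1(\omega)},\qquad \mathcal L_o(\omega)=\mathcal L_1(\omega)\mathcal C_4(\omega)+(\Gamma(\omega)-1)\mathcal L_\rho(\omega).$$ Assume these are meaningful: no block has an eigenvalue $jn\omega$ with $n$ odd, $A_\rho e^{A_R\pi/\omega}+I$ is invertible, and $\Delta_c^1(\omega)\ne0$. **Claim.** The series in $\Gamma(\omega)$ converges, its denominator, $1+\mathcal L_o(\omega)$ and all $1+\mathcal L_l(n\omega)$ ($n$ odd) are nonzero, and with $R^n$ the phasor of $r^n(t)=|R|\sin n\omega t$ the functions $\mathcal S_n=E^n/R^n$, $\mathcal T_n=Y^n/R^n$, $\mathcal{CS}_n=U^n/R^n$ are as follows.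 For $n=1$: $\mathcal S_1=\frac{1}{1+\mathcal L_o(\omega)}$, $\mathcal T_1=\frac{\mathcal L_o(\omega)}{\mathcal C_4(\omega)(1+\mathcal L_o(\omega))}$, $\mathcal{CS}_1=\frac{\mathcal L_o(\omega)}{\mathcal C_4(\omega)\mathcal P(\omega)(1+\mathcal L_o(\omega))}$. For odd $n>1$: $\mathcal T_n=\mathcal S_l(n\omega)\,|\mathcal S_1(\omega)|e^{jn\angle\mathcal S_1(\omega)}\,\Gamma(\omega)\mathcal L_n(\omega)$, $\mathcal S_n=-\mathcal T_n\,\mathcal C_4(n\omega)$, $\mathcal{CS}_n=\mathcal T_n/\mathcal P(n\omega)$. For even $n\ge2$: $\mathcal S_n=\mathcal T_n=\mathcal{CS}_n=0$. (Formulas that divide by $\mathcal C_4(\omega)$ or $\mathcal P(n\omega)$ are claimed when these are nonzero.) -/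

import Mathlib

open scoped Matrix

noncomputable section

/-- A finite-dimensional real single-input single-output LTI system
`x' = A x + B u`, `output = C x + D u`. -/
structure LTI where
  order : ℕ
  A : Matrix (Fin order) (Fin order) ℝ
  B : Fin order → ℝ
  C : Fin order → ℝ
  D : ℝ

namespace LTI

/-- The matrix `s I - A` over `ℂ`. -/
def charMat (G : LTI) (s : ℂ) : Matrix (Fin G.order) (Fin G.order) ℂ :=
  s • (1 : Matrix (Fin G.order) (Fin G.order) ℂ) - G.A.map Complex.ofReal

/-- Input-to-state transfer vector `(s I - A)⁻¹ B`. -/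
def stateTF (G : LTI) (s : ℂ) : Fin G.order → ℂ :=
  (G.charMat s)⁻¹ *ᵥ (fun i => (G.B i : ℂ))

/-- Transfer function `C (s I - A)⁻¹ B + D`. -/
def tf (G : LTI) (s : ℂ) : ℂ :=
  (fun i => (G.C i : ℂ)) ⬝ᵥ G.stateTF s + (G.D : ℂ)

end LTI

/-- The blocks of the feedback loop. -/
inductive Block where
  | Cr | C1 | C2 | C3 | C4 | Cs | P
  deriving DecidableEq

instance : Fintype Block where
  elems := {Block.Cr, Block.C1, Block.C2, Block.C3, Block.C4, Block.Cs, Block.P}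
  complete := by intro b; cases b <;> decide

/-- The generalized reset feedback system: an LTI system for each block (for `Cr` it is the
base-linear controller `(A_R, B_R, C_R, D_R)`), and the reset value `γ` of the single reset
state, which is the first state of `Cr`. -/
structure ResetLoop where
  sys : Block → LTI
  order_pos : 0 < (sys Block.Cr).order
  γ : ℝ
  γ_mem : γ ∈ Set.Ioc (-1 : ℝ) 1

/-- Sinusoidal phasor of the `n`-th harmonic of a `2π/ω`-periodic signal `f`: the complex number
`F` such that the `n`-th harmonic of `f` is `‖F‖ * sin (n ω t + arg F)`. -/
def phasor (ω : ℝ) (n : ℕ) (f : ℝ → ℝ) : ℂ :=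
  2 * Complex.I * ((ω / (2 * Real.pi) : ℝ) : ℂ) *
    ∫ t in (0 : ℝ)..(2 * Real.pi / ω),
      (f t : ℂ) * Complex.exp (-(Complex.I * ((n * ω * t : ℝ) : ℂ)))

/-- A (rational) function `H` is strictly positive real if, for some `ε > 0`, the function
`s ↦ H (s - ε)` is analytic with nonnegative real part on the open right half plane. -/
def StrictlyPositiveReal (H : ℂ → ℂ) : Prop :=
  ∃ ε : ℝ, 0 < ε ∧ AnalyticOnNhd ℂ H {s | -ε < s.re} ∧ ∀ s : ℂ, -ε < s.re → 0 ≤ (H s).re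

/-- All eigenvalues lie in the open left half plane. -/
def HurwitzMatrix {ι : Type} [Fintype ι] [DecidableEq ι] (M : Matrix ι ι ℝ) : Prop :=
  ∀ μ ∈ spectrum ℂ (M.map Complex.ofReal), μ.re < 0

namespace ResetLoop

variable (S : ResetLoop)

/-- Index of the reset state inside the state of `Cr`. -/
def rho : Fin (S.sys Block.Cr).order := ⟨0, S.order_pos⟩

/-- The reset matrix `A_ρ = diag(γ, 1, …, 1)`. -/
def Arho : Matrix (Fin (S.sys Block.Cr).order) (Fin (S.sys Block.Cr).order) ℝ :=
  Matrix.diagonal (fun i => if i = S.rho then S.γ else 1)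

/-! ### The closed loop in the time domain -/

/-- Index set of the state of the whole closed loop. -/
abbrev Idx : Type := Σ b : Block, Fin (S.sys b).order

/-- Output of block `b` when the state is `x` and the inputs of the blocks are `inp`. -/
def out (x : S.Idx → ℝ) (inp : Block → ℝ) (b : Block) : ℝ :=
  (S.sys b).C ⬝ᵥ (fun i => x ⟨b, i⟩) + (S.sys b).D * inp b

/-- The block diagram with reference value `r`: the error `e = r - (output of C4)` enters `C1`,
the output `z` of `C1` enters `Cr`, `C2` and the shaping filter `Cs`, the sum `v` of the outputs
of `Cr` and `C2` enters `C3`, the control input `u` (output of `C3`) enters the plant, and the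
plant output `y` enters `C4`. -/
structure Diagram (x : S.Idx → ℝ) (r : ℝ) (inp : Block → ℝ) : Prop where
  e_eq : inp Block.C1 = r - S.out x inp Block.C4
  zr_eq : inp Block.Cr = S.out x inp Block.C1
  z2_eq : inp Block.C2 = S.out x inp Block.C1
  zs_eq : inp Block.Cs = S.out x inp Block.C1
  v_eq : inp Block.C3 = S.out x inp Block.Cr + S.out x inp Block.C2
  u_eq : inp Block.P = S.out x inp Block.C3
  y_eq : inp Block.C4 = S.out x inp Block.P

/-- Right-hand side of the flow dynamics of all blocks. -/
def field (x : S.Idx → ℝ) (inp : Block → ℝ) : S.Idx → ℝ :=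
  fun q => ((S.sys q.1).A *ᵥ (fun i => x ⟨q.1, i⟩)) q.2 + (S.sys q.1).B q.2 * inp q.1

/-- The jump: `A_ρ` acts on the state of `Cr`; all other states are unchanged. -/
def jump (x : S.Idx → ℝ) : S.Idx → ℝ
  | ⟨Block.Cr, i⟩ => (S.Arho *ᵥ (fun k => x ⟨Block.Cr, k⟩)) i
  | q => x q

/-- The reset-triggered signal `z_s`, the output of the shaping filter. -/
def trigger (x : ℝ → S.Idx → ℝ) (inp : ℝ → Block → ℝ) (t : ℝ) : ℝ :=
  S.out (x t) (inp t) Block.Cs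

/-- The set of reset instants given by the zero-crossing law. -/
def resetInstants (x : ℝ → S.Idx → ℝ) (inp : ℝ → Block → ℝ) : Set ℝ :=
  {t | S.trigger x inp t = 0}

/-- `x` (with block inputs `inp`) is a `2π/ω`-periodic steady-state response of the closed-loop
reset system to `r(t) = R sin(ωt)`. At a reset instant `t` the value `x t` is the value just
before the reset. -/
structure IsSteadyState (ω R : ℝ) (x : ℝ → S.Idx → ℝ) (inp : ℝ → Block → ℝ) : Prop where
  diagram : ∀ t, S.Diagram (x t) (R * Real.sin (ω * t)) (inp t)
  flow : ∀ t, t ∉ S.resetInstants x inp → HasDerivAt x (S.field (x t) (inp t)) t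
  left_cont : ∀ t ∈ S.resetInstants x inp, ContinuousWithinAt x (Set.Iic t) t
  reset : ∀ t ∈ S.resetInstants x inp,
    Filter.Tendsto x (nhdsWithin t (Set.Ioi t)) (nhds (S.jump (x t)))
  periodic : Function.Periodic x (2 * Real.pi / ω)

/-- Two resets per cycle, governed by the first harmonic of the trigger signal: the first harmonic
`z_s¹` of `z_s` is not zero, and `z_s` vanishes exactly where `z_s¹` does. This holds in
particular if `z_s = z_s¹ ≠ 0`. -/
structure IsTwoReset (ω : ℝ) (x : ℝ → S.Idx → ℝ) (inp : ℝ → Block → ℝ) : Prop where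
  first_ne_zero : phasor ω 1 (S.trigger x inp) ≠ 0
  zeros : ∀ t, S.trigger x inp t = 0 ↔
    ‖phasor ω 1 (S.trigger x inp)‖ *
      Real.sin (ω * t + (phasor ω 1 (S.trigger x inp)).arg) = 0

/-! ### The `H_β` condition -/

/-- `Acl` is the system matrix of the unforced base-linear closed loop and `czs` is the row that
expresses the trigger signal `z_s` through its state. -/
def IsBaseLinear (Acl : Matrix S.Idx S.Idx ℝ) (czs : S.Idx → ℝ) : Prop :=
  ∀ x inp, S.Diagram x 0 inp →
    S.field x inp = Acl *ᵥ x ∧ S.out x inp Block.Cs = czs ⬝ᵥ x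

/-- Unit vector of the reset state in the closed-loop state space. -/
def eRho : S.Idx → ℝ := Pi.single ⟨Block.Cr, S.rho⟩ 1

/-- The `H_β` condition: the base-linear closed loop is Hurwitz, and for some `β ∈ ℝ` and
`p > 0` the transfer function `H_β(s) = C₀ (s I - A_cl)⁻¹ B₀` is strictly positive real, where
`B₀` is the unit vector of the reset state and `C₀ = β c_zs + p B₀ᵀ`. -/
def HBeta : Prop :=
  ∃ (Acl : Matrix S.Idx S.Idx ℝ) (czs : S.Idx → ℝ) (β p : ℝ),
    S.IsBaseLinear Acl czs ∧ HurwitzMatrix Acl ∧ 0 < p ∧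
    StrictlyPositiveReal (fun s =>
      (fun q => ((β * czs q + p * S.eRho q : ℝ) : ℂ)) ⬝ᵥ
        ((s • (1 : Matrix S.Idx S.Idx ℂ) - Acl.map Complex.ofReal)⁻¹ *ᵥ
          (fun q => (S.eRho q : ℂ))))

/-! ### Open-loop frequency-domain quantities -/

/-- The complex frequency `j n ω`. -/
def jw (ω : ℝ) (n : ℕ) : ℂ := Complex.I * ((n * ω : ℝ) : ℂ)

/-- Frequency response of block `b` at `n ω`; for `Cr` this is `C_l(nω)`. -/
def fr (ω : ℝ) (n : ℕ) (b : Block) : ℂ := (S.sys b).tf (jw ω n)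

/-- `Δ_l(nω) = (jnωI - A_R)⁻¹ B_R`. -/
def DeltaL (ω : ℝ) (n : ℕ) : Fin (S.sys Block.Cr).order → ℂ :=
  (S.sys Block.Cr).stateTF (jw ω n)

/-- The row vector `Δ_x(nω) = C_R (jnωI - A_R)⁻¹ jnω`. -/
def DeltaX (ω : ℝ) (n : ℕ) : Fin (S.sys Block.Cr).order → ℂ :=
  jw ω n • ((fun i => ((S.sys Block.Cr).C i : ℂ)) ᵥ* ((S.sys Block.Cr).charMat (jw ω n))⁻¹)

/-- `Δ_c(ω) = |Δ_l(ω)| sin(∠Δ_l(ω) - ∠C_s(ω))`, componentwise. -/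
def DeltaC (ω : ℝ) : Fin (S.sys Block.Cr).order → ℝ := fun i =>
  ‖S.DeltaL ω 1 i‖ * Real.sin ((S.DeltaL ω 1 i).arg - (S.fr ω 1 Block.Cs).arg)

/-- The matrix exponential `e^{A_R π/ω}`. -/
def expAR (ω : ℝ) : Matrix (Fin (S.sys Block.Cr).order) (Fin (S.sys Block.Cr).order) ℝ :=
  NormedSpace.exp ((Real.pi / ω) • (S.sys Block.Cr).A)

/-- `Δ_q(ω) = (I + e^{A_R π/ω}) (A_ρ e^{A_R π/ω} + I)⁻¹ (A_ρ - I) Δ_c(ω)`. -/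
def DeltaQ (ω : ℝ) : Fin (S.sys Block.Cr).order → ℝ :=
  ((1 + S.expAR ω) * (S.Arho * S.expAR ω + 1)⁻¹ * (S.Arho - 1)) *ᵥ S.DeltaC ω

/-- `C_ρⁿ(ω) = 2 Δ_x(nω) Δ_q(ω) e^{jn∠C_s(ω)} / (nπ)`. -/
def Crho (ω : ℝ) (n : ℕ) : ℂ :=
  2 * (S.DeltaX ω n ⬝ᵥ (fun i => (S.DeltaQ ω i : ℂ))) *
    Complex.exp (Complex.I * ((n * (S.fr ω 1 Block.Cs).arg : ℝ) : ℂ)) / ((n * Real.pi : ℝ) : ℂ)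

/-- The open-loop higher-order describing function `L_n(ω)`. -/
def Ln (ω : ℝ) (n : ℕ) : ℂ :=
  if n = 1 then
    S.fr ω 1 Block.C1 * (S.fr ω 1 Block.Cr + S.Crho ω 1 + S.fr ω 1 Block.C2) *
      S.fr ω 1 Block.C3 * S.fr ω 1 Block.P
  else if Odd n then
    S.fr ω 1 Block.C1 *
      Complex.exp (Complex.I * ((((n : ℝ) - 1) * (S.fr ω 1 Block.C1).arg : ℝ) : ℂ)) *
      S.Crho ω n * S.fr ω n Block.C3 * S.fr ω n Block.P
  else 0

/-! ### Closed-loop frequency-domain quantities -/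

/-- `L_l(nω)`, the loop gain of the base-linear system. -/
def Ll (ω : ℝ) (n : ℕ) : ℂ :=
  (S.fr ω n Block.Cr + S.fr ω n Block.C2) * S.fr ω n Block.C3 * S.fr ω n Block.P *
    S.fr ω n Block.C4 * S.fr ω n Block.C1

/-- `L_ρ(nω)`. -/
def Lrho (ω : ℝ) (n : ℕ) : ℂ :=
  S.Crho ω n * S.fr ω n Block.C3 * S.fr ω n Block.P * S.fr ω n Block.C4 * S.fr ω n Block.C1

/-- `S_l(nω) = 1/(1 + L_l(nω))`. -/
def Sl (ω : ℝ) (n : ℕ) : ℂ := 1 / (1 + S.Ll ω n)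

/-- `Ψ_n(ω) = |L_ρ(nω)|/|1 + L_l(nω)|`. -/
def Psi (ω : ℝ) (n : ℕ) : ℝ := ‖S.Lrho ω n‖ / ‖1 + S.Ll ω n‖

/-- The reset-state component of `Δ_c¹(ω)`. -/
def DeltaC1 (ω : ℝ) : ℝ := S.DeltaC ω S.rho

/-- The reset-state component of `Δ_cⁿ(ω)`, `n > 1`. -/
def DeltaCn (ω : ℝ) (n : ℕ) : ℝ :=
  -(‖S.DeltaL ω n S.rho‖ * Real.sin ((S.DeltaL ω n S.rho).arg + (S.Lrho ω n).arg
    - (1 + S.Ll ω n).arg - n * (S.fr ω 1 Block.Cs).arg))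

/-- The sum `∑_{n = 3, 5, 7, …} Ψ_n(ω) Δ_cⁿ(ω)`. -/
def PsiSum (ω : ℝ) : ℝ := ∑' k : ℕ, S.Psi ω (2 * k + 3) * S.DeltaCn ω (2 * k + 3)

/-- `Γ(ω)`. -/
def Gam (ω : ℝ) : ℝ := 1 / (1 - S.PsiSum ω / S.DeltaC1 ω)

/-- `L_o(ω) = L_1(ω) C_4(ω) + (Γ(ω) - 1) L_ρ(ω)`. -/
def Lo (ω : ℝ) : ℂ :=
  S.Ln ω 1 * S.fr ω 1 Block.C4 + ((S.Gam ω : ℂ) - 1) * S.Lrho ω 1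

/-- The formula `1/(1 + L_o(ω))`. -/
def S1 (ω : ℝ) : ℂ := 1 / (1 + S.Lo ω)

/-- The common factor `S_l(nω) |S_1(ω)| e^{jn∠S_1(ω)} Γ(ω) L_n(ω)`. -/
def hoFactor (ω : ℝ) (n : ℕ) : ℂ :=
  S.Sl ω n * ((‖S.S1 ω‖ : ℂ) * Complex.exp (Complex.I * ((n * (S.S1 ω).arg : ℝ) : ℂ))) *
    (S.Gam ω : ℂ) * S.Ln ω n

end ResetLoop

/-- The `n`-th higher-order describing function from `r(t) = R sin(ωt)` to a `2π/ω`-periodic signal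
`f`: the ratio of the `n`-th harmonic of `f` to the virtual harmonic `rⁿ(t) = R sin(nωt)`. -/
def hosidf (ω R : ℝ) (f : ℝ → ℝ) (n : ℕ) : ℂ :=
  phasor ω n f / phasor ω n (fun t => R * Real.sin (n * ω * t))

end

section

open Set MeasureTheory Filter Topology

/-! ### Fourier series of a continuously differentiable function on an interval -/

/-! The proof turns the resets into one unknown amplitude and determines that amplitude from a
Fourier series.

Half-wave antisymmetry comes first. With `h = π/ω`, the sum `w(t) = x(t) + x(t+h)` is an
`h`-periodic response of the unforced base-linear loop that jumps once per period, at an instant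
where its trigger vanishes. The jumps act as an impulse train of size `g`, so the output `C₀ w` has
Fourier coefficients proportional to `g H_β(jω_k)`. Summing them at the jump yields the average of
the two one-sided values. Positive realness makes `g` times this average nonnegative, while the
reset law makes it a nonpositive multiple of `(1 - γ²)` times the squared reset state. Hence `g =
0`, and a periodic solution of a Hurwitz system vanishes (`eq_zero_of_strictlyPositiveReal`,
`IsSteadyState.add_half_period`). So even harmonics are zero, and odd ones are integrals over one
reset-free arc.

On that arc each differential equation becomes an algebraic equation, with one extra term from the
jump of `Cr` (`charMat_mulVec_statePhasor`). Since `A_ρ - I` has rank one, this jump is `κ Δ_q` for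
a real scalar `κ`, and `κ Δ_c¹` is the reset component of the continuous, antiperiodic part of the
controller state at the reset instant. The Fourier series of that component
(`exists_resetAmplitude`) has first term `|Z¹| Δ_c¹`. Its higher terms are `κ Ψ_n Δ_cⁿ`, because
every higher harmonic of `z` is excited by the jump alone. Solving gives `κ = Γ |Z¹|`, together with
convergence of the series and a nonzero denominator (`resetAmplitude_eq`).

The first harmonic then obeys a linear loop with gain `L_o`, and the higher ones a base-linear loop
driven by the jump. Nonvanishing of `1 + L_l` follows from the Hurwitz property
(`one_add_Ll_ne_zero`), and that of `1 + L_o` from `R ≠ 0`. -/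

theorem fourier_coe_eq_cexp {T : ℝ} (n : ℤ) (x : ℝ) :
    fourier n (x : AddCircle T) = Complex.exp (2 * Real.pi * Complex.I * n * x / T) :=
  fourier_coe_apply

theorem intervalIntegrable_of_continuousOn_Icc {E : Type*} [NormedAddCommGroup E] {a b : ℝ}
    (hab : a ≤ b) {f : ℝ → E} (hf : ContinuousOn f (Icc a b)) :
    IntervalIntegrable f volume a b :=
  ContinuousOn.intervalIntegrable (by rwa [uIcc_of_le hab])

/-- Integration by parts has no boundary term, so for `n ≠ 0` the coefficient is of size `|c_n(f')|
/ |n|`. By Bessel and the inequality `c/n ≤ c² + 1/n²` this is summable. -/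
theorem summable_fourierCoeffOn {a b : ℝ} (hab : a < b) {f f' : ℝ → ℂ}
    (hf : ContinuousOn f (Icc a b)) (hd : ∀ x ∈ Ioo a b, HasDerivAt f (f' x) x)
    (hf' : ContinuousOn f' (Icc a b)) (h : f a = f b) : Summable (fourierCoeffOn hab f) := by
  have hL2 : MemLp f' 2 (volume.restrict (Ioc a b)) := by
    obtain ⟨C, hC⟩ := isCompact_Icc.exists_bound_of_continuousOn hf'
    refine MemLp.of_bound ((hf'.mono Ioc_subset_Icc_self).aestronglyMeasurable measurableSet_Ioc)
      C ?_
    exact (ae_restrict_iff' measurableSet_Ioc).2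
      (Filter.Eventually.of_forall fun x hx => hC x (Ioc_subset_Icc_self hx))
  have h1 := (hasSum_sq_fourierCoeffOn hab hL2).summable
  have h2 : Summable fun n : ℤ => 1 / (n : ℝ) ^ 2 :=
    (Real.summable_one_div_int_pow (p := 2)).2 (by norm_num)
  refine Summable.of_norm_bounded_eventually
    (g := fun n : ℤ => (b - a) * (‖fourierCoeffOn hab f' n‖ ^ 2 + 1 / (n : ℝ) ^ 2))
    ((h1.add h2).mul_left _) ?_
  filter_upwards [Filter.eventually_cofinite_ne (0 : ℤ)] with n hn
  rw [fourierCoeffOn_of_hasDerivAt_Ioo hab hn (by rwa [uIcc_of_le hab.le])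
    (by rwa [min_eq_left hab.le, max_eq_right hab.le])
    (intervalIntegrable_of_continuousOn_Icc hab.le hf'), h, sub_self, mul_zero, zero_sub]
  have hba : 0 < b - a := sub_pos.2 hab
  rw [norm_mul, norm_neg, norm_mul, norm_div, ← Complex.ofReal_sub, Complex.norm_real,
    Real.norm_of_nonneg hba.le]
  have hn' : (0 : ℝ) < |(n : ℝ)| := abs_pos.2 (by exact_mod_cast hn)
  have hden : ‖(-2 * Real.pi * Complex.I * n : ℂ)‖ = 2 * Real.pi * |(n : ℝ)| := by
    simp [abs_of_pos Real.pi_pos]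
  rw [hden, norm_one]
  set c := ‖fourierCoeffOn hab f' n‖
  have hc : 0 ≤ c := norm_nonneg _
  have h3 : 1 / (2 * Real.pi * |(n : ℝ)|) ≤ 1 / |(n : ℝ)| := by
    apply one_div_le_one_div_of_le hn'
    nlinarith [Real.pi_gt_three]
  calc 1 / (2 * Real.pi * |(n : ℝ)|) * ((b - a) * c)
      ≤ 1 / |(n : ℝ)| * ((b - a) * c) := by gcongr
    _ = (b - a) * (c * (1 / |(n : ℝ)|)) := by ring
    _ ≤ (b - a) * (c ^ 2 + (1 / |(n : ℝ)|) ^ 2) := by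
        gcongr
        nlinarith [sq_nonneg (c - 1 / |(n : ℝ)|), sq_nonneg (c + 1 / |(n : ℝ)|)]
    _ = (b - a) * (c ^ 2 + 1 / (n : ℝ) ^ 2) := by rw [div_pow, sq_abs, one_pow]

theorem hasSum_fourierCoeffOn {a b : ℝ} (hab : a < b) {f f' : ℝ → ℂ}
    (hf : ContinuousOn f (Icc a b)) (hd : ∀ x ∈ Ioo a b, HasDerivAt f (f' x) x)
    (hf' : ContinuousOn f' (Icc a b)) (h : f a = f b) {x : ℝ} (hx : x ∈ Icc a b) :
    HasSum (fun n : ℤ => fourierCoeffOn hab f n * fourier n (x : AddCircle (b - a))) (f x) := by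
  have := Fact.mk (sub_pos.2 hab)
  have hb : a + (b - a) = b := by ring
  have hcont : Continuous (AddCircle.liftIoc (b - a) a f) :=
    AddCircle.liftIoc_continuous (by rw [hb, h]) (by rwa [hb])
  have key := has_pointwise_sum_fourier_series_of_summable
    (f := (⟨_, hcont⟩ : C(AddCircle (b - a), ℂ))) (h := summable_fourierCoeffOn hab hf hd hf' h)
  have hval : ∀ y ∈ Ioc a b, AddCircle.liftIoc (b - a) a f (y : AddCircle (b - a)) = f y :=
    fun y hy => AddCircle.liftIoc_coe_apply (by rwa [hb])
  rcases eq_or_lt_of_le hx.1 with rfl | hlt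
  -- The lift to the circle reads values on `Ioc a b`, so the point `a` is evaluated at its
  -- representative `b`.
  · have := key (b : AddCircle (b - a))
    simp only [ContinuousMap.coe_mk] at this
    rw [hval b ⟨hab, le_rfl⟩, ← h] at this
    have hcoe : (b : AddCircle (b - a)) = (a : AddCircle (b - a)) := by
      simpa using AddCircle.coe_add_period (b - a) a
    rw [hcoe] at this
    exact this
  · have := key (x : AddCircle (b - a))
    simp only [ContinuousMap.coe_mk] at this
    rw [hval x ⟨hlt, hx.2⟩] at this
    exact this

/-! ### Exponential integrals over an interval -/

/-- The integral `∫ f(t) e^{-st} dt` over `[a, b]`. -/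
noncomputable def expIntegral (a b : ℝ) (s : ℂ) (f : ℝ → ℝ) : ℂ :=
  ∫ t in a..b, (f t : ℂ) * Complex.exp (-(s * t))

section expIntegral

variable {a b : ℝ} {s : ℂ} {f g : ℝ → ℝ}

theorem intervalIntegrable_mul_cexp (hab : a ≤ b) (hf : ContinuousOn f (Icc a b)) (s : ℂ) :
    IntervalIntegrable (fun t : ℝ => (f t : ℂ) * Complex.exp (-(s * t))) volume a b := by
  refine intervalIntegrable_of_continuousOn_Icc hab (ContinuousOn.mul ?_ ?_)
  · exact Complex.continuous_ofReal.comp_continuousOn hf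
  · fun_prop

theorem expIntegral_add (hab : a ≤ b) (hf : ContinuousOn f (Icc a b))
    (hg : ContinuousOn g (Icc a b)) :
    expIntegral a b s (fun t => f t + g t) = expIntegral a b s f + expIntegral a b s g := by
  unfold expIntegral
  rw [← intervalIntegral.integral_add (intervalIntegrable_mul_cexp hab hf s)
    (intervalIntegrable_mul_cexp hab hg s)]
  congr 1
  ext t
  push_cast
  ring

theorem expIntegral_const_mul (c : ℝ) :
    expIntegral a b s (fun t => c * f t) = c * expIntegral a b s f := by
  unfold expIntegral
  rw [← intervalIntegral.integral_const_mul]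
  congr 1
  ext t
  push_cast
  ring

theorem expIntegral_dotProduct {ι : Type*} [Fintype ι] (hab : a ≤ b) (c : ι → ℝ)
    {X : ℝ → ι → ℝ} (hX : ContinuousOn X (Icc a b)) :
    expIntegral a b s (fun t => c ⬝ᵥ X t) =
      (fun i => (c i : ℂ)) ⬝ᵥ fun i => expIntegral a b s (fun t => X t i) := by
  unfold dotProduct
  simp_rw [← expIntegral_const_mul]
  unfold expIntegral
  rw [← intervalIntegral.integral_finsetSum]
  · congr 1
    ext t
    push_cast
    rw [Finset.sum_mul]
  · intro i _
    refine intervalIntegrable_mul_cexp hab (f := fun t => c i * X t i) ?_ s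
    exact continuousOn_const.mul (continuousOn_pi.1 hX i)

theorem expIntegral_congr (hab : a ≤ b) (h : ∀ t ∈ Ioc a b, f t = g t) :
    expIntegral a b s f = expIntegral a b s g := by
  unfold expIntegral
  refine intervalIntegral.integral_congr_ae (ae_of_all _ fun t ht => ?_)
  rw [uIoc_of_le hab] at ht
  rw [h t ht]

theorem hasDerivAt_cexp_neg_mul (s : ℂ) (t : ℝ) :
    HasDerivAt (fun t : ℝ => Complex.exp (-(s * t))) (-s * Complex.exp (-(s * t))) t := by
  have h1 : HasDerivAt (fun t : ℝ => -(s * (t : ℂ))) (-(s * 1)) t :=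
    ((Complex.ofRealCLM.hasDerivAt (x := t)).const_mul s).neg
  convert h1.cexp using 1
  ring

theorem expIntegral_deriv (hab : a ≤ b) (hf : ContinuousOn f (Icc a b)) {f' : ℝ → ℝ}
    (hd : ∀ t ∈ Ioo a b, HasDerivAt f (f' t) t) (hf' : ContinuousOn f' (Icc a b)) :
    expIntegral a b s f' =
      f b * Complex.exp (-(s * b)) - f a * Complex.exp (-(s * a)) + s * expIntegral a b s f := by
  have hfc : ContinuousOn (fun t => (f t : ℂ)) (uIcc a b) := by
    rw [uIcc_of_le hab]
    exact Complex.continuous_ofReal.comp_continuousOn hf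
  have hec : Continuous fun t : ℝ => Complex.exp (-(s * t)) := by fun_prop
  have h := intervalIntegral.integral_mul_deriv_eq_deriv_mul_of_hasDerivAt (a := a) (b := b)
    (u := fun t => (f t : ℂ)) (u' := fun t => (f' t : ℂ))
    (v := fun t : ℝ => Complex.exp (-(s * t))) (v' := fun t : ℝ => -s * Complex.exp (-(s * t)))
    hfc hec.continuousOn
    (fun t ht => by
      rw [min_eq_left hab, max_eq_right hab] at ht
      exact (hd t ht).ofReal_comp)
    (fun t _ => hasDerivAt_cexp_neg_mul s t)
    (intervalIntegrable_of_continuousOn_Icc hab (Complex.continuous_ofReal.comp_continuousOn hf'))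
    ((continuous_const.mul hec).intervalIntegrable _ _)
  have h2 : ∫ t in a..b, (f t : ℂ) * (-s * Complex.exp (-(s * t))) =
      -s * expIntegral a b s f := by
    unfold expIntegral
    rw [← intervalIntegral.integral_const_mul]
    congr 1
    ext t
    ring
  rw [h2] at h
  change _ = _ - expIntegral a b s f' at h
  linear_combination h

/-- The Laplace-type transform of a linear differential equation on an interval. -/
theorem mulVec_expIntegral_of_hasDerivAt {ι : Type*} [Fintype ι] [DecidableEq ι] (hab : a ≤ b)
    {A : Matrix ι ι ℝ} {B : ι → ℝ} {u : ℝ → ℝ} {X : ℝ → ι → ℝ} (hX : ContinuousOn X (Icc a b))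
    (hu : ContinuousOn u (Icc a b))
    (hd : ∀ t ∈ Ioo a b, HasDerivAt X (fun i => (A *ᵥ X t) i + B i * u t) t) :
    (s • (1 : Matrix ι ι ℂ) - A.map Complex.ofReal) *ᵥ
        (fun i => expIntegral a b s (fun t => X t i)) =
      fun i => B i * expIntegral a b s u + X a i * Complex.exp (-(s * a)) -
        X b i * Complex.exp (-(s * b)) := by
  ext i
  have hAX : ContinuousOn (fun t => A i ⬝ᵥ X t) (Icc a b) := by
    unfold dotProduct
    exact continuousOn_finsetSum _ fun j _ => continuousOn_const.mul (continuousOn_pi.1 hX j)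
  have hBu : ContinuousOn (fun t => B i * u t) (Icc a b) := continuousOn_const.mul hu
  have h := expIntegral_deriv (s := s) hab (continuousOn_pi.1 hX i)
    (f' := fun t => A i ⬝ᵥ X t + B i * u t)
    (fun t ht => (hasDerivAt_pi.1 (hd t ht)) i) (hAX.add hBu)
  rw [expIntegral_add hab hAX hBu, expIntegral_const_mul, expIntegral_dotProduct hab _ hX] at h
  rw [Matrix.sub_mulVec, Matrix.smul_mulVec, Matrix.one_mulVec]
  simp only [Pi.sub_apply, Pi.smul_apply, smul_eq_mul]
  have h3 : ((A.map Complex.ofReal) *ᵥ fun i => expIntegral a b s (fun t => X t i)) i =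
      (fun j => ((A i j : ℝ) : ℂ)) ⬝ᵥ fun i => expIntegral a b s (fun t => X t i) := rfl
  rw [h3]
  linear_combination -h

/-- Combined with `expIntegral_conj`, this makes the coefficients of a reflected real function the
conjugates of the original ones, up to a phase. It serves to symmetrise a function whose end values
differ. -/
theorem expIntegral_reflect :
    expIntegral a b s (fun t => f (a + b - t)) =
      Complex.exp (-(s * (a + b : ℝ))) * expIntegral a b (-s) f := by
  unfold expIntegral
  have h := intervalIntegral.integral_comp_sub_left (a := a) (b := b)
    (fun t : ℝ => (f t : ℂ) * Complex.exp (-(s * ((a + b : ℝ) - t)))) (a + b)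
  rw [add_sub_cancel_right, add_sub_cancel_left] at h
  rw [← intervalIntegral.integral_const_mul]
  refine Eq.trans ?_ (h.trans ?_)
  · congr 1
    ext t
    push_cast
    ring_nf
  · congr 1
    ext t
    rw [mul_left_comm, ← Complex.exp_add]
    ring_nf

theorem expIntegral_conj (σ : ℝ) :
    expIntegral a b (-(Complex.I * σ)) f =
      (starRingEnd ℂ) (expIntegral a b (Complex.I * σ) f) := by
  unfold expIntegral
  rw [← intervalIntegral.intervalIntegral_conj]
  congr 1
  ext t
  simp [← Complex.exp_conj]

theorem hasSum_of_forall_eq {β : Type*} {f g : β → ℂ} {z : ℂ} (hf : HasSum f z)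
    (h : ∀ k, g k = f k) : HasSum g z := by
  rwa [funext h]

/-- Fourier expansion of a continuously differentiable function on an interval whose values at
the end points agree up to the factor `e^{iσ(b-a)}`. -/
theorem hasSum_expIntegral (hab : a < b) (hf : ContinuousOn f (Icc a b)) {f' : ℝ → ℝ}
    (hd : ∀ t ∈ Ioo a b, HasDerivAt f (f' t) t) (hf' : ContinuousOn f' (Icc a b)) {σ : ℝ}
    (h : f a * Complex.exp (-(Complex.I * σ * a)) = f b * Complex.exp (-(Complex.I * σ * b)))
    {x : ℝ} (hx : x ∈ Icc a b) :
    HasSum (fun k : ℤ =>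
      expIntegral a b (Complex.I * (σ + 2 * Real.pi * k / (b - a) : ℝ)) f *
        Complex.exp (Complex.I * (σ + 2 * Real.pi * k / (b - a) : ℝ) * x))
      ((b - a) * f x) := by
  have hfc : ContinuousOn (fun t => (f t : ℂ)) (Icc a b) :=
    Complex.continuous_ofReal.comp_continuousOn hf
  have hfc' : ContinuousOn (fun t => (f' t : ℂ)) (Icc a b) :=
    Complex.continuous_ofReal.comp_continuousOn hf'
  -- Multiplying by `e^{-iσt}` removes the twist at the end points; the factor `e^{iσx}` is restored
  -- after summation.
  have key := hasSum_fourierCoeffOn hab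
    (f := fun t => (f t : ℂ) * Complex.exp (-(Complex.I * σ * t)))
    (f' := fun t => (f' t : ℂ) * Complex.exp (-(Complex.I * σ * t)) +
      f t * (-(Complex.I * σ) * Complex.exp (-(Complex.I * σ * t))))
    (hfc.mul (by fun_prop))
    (fun t ht => (hd t ht).ofReal_comp.mul (hasDerivAt_cexp_neg_mul _ t))
    ((hfc'.mul (by fun_prop)).add (hfc.mul (by fun_prop))) h hx
  have hba : ((b - a : ℝ) : ℂ) ≠ 0 := Complex.ofReal_ne_zero.2 (sub_pos.2 hab).ne'
  have key2 := key.mul_left (((b - a : ℝ) : ℂ) * Complex.exp (Complex.I * σ * x))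
  have hone : Complex.exp (Complex.I * σ * x) * Complex.exp (-(Complex.I * σ * x)) = 1 := by
    rw [← Complex.exp_add, add_neg_cancel, Complex.exp_zero]
  have hval : ((b - a : ℝ) : ℂ) * Complex.exp (Complex.I * σ * x) *
      (f x * Complex.exp (-(Complex.I * σ * x))) = (b - a) * f x := by
    push_cast
    linear_combination ((b - a) * f x : ℂ) * hone
  rw [hval] at key2
  refine hasSum_of_forall_eq key2 fun k => ?_
  rw [fourierCoeffOn_eq_integral, fourier_coe_eq_cexp, Complex.real_smul]
  have : ∫ t in a..b, fourier (-k) (t : AddCircle (b - a)) •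
      ((f t : ℂ) * Complex.exp (-(Complex.I * σ * t))) =
      expIntegral a b (Complex.I * (σ + 2 * Real.pi * k / (b - a) : ℝ)) f := by
    unfold expIntegral
    congr 1
    ext t
    rw [fourier_coe_eq_cexp, smul_eq_mul, mul_left_comm, ← Complex.exp_add]
    congr 2
    push_cast
    ring
  rw [this]
  have he : Complex.exp (Complex.I * (σ + 2 * Real.pi * k / (b - a) : ℝ) * x) =
      Complex.exp (Complex.I * σ * x) *
        Complex.exp (2 * Real.pi * Complex.I * k * x / (b - a : ℝ)) := by
    rw [← Complex.exp_add]
    congr 1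
    push_cast
    ring
  rw [he]
  push_cast at hba ⊢
  field_simp

end expIntegral

/-! ### Periodic solutions of linear differential equations -/

section LinearODE

variable {ι : Type} [Fintype ι] {a b : ℝ} {A : Matrix ι ι ℝ} {X : ℝ → ι → ℝ}

theorem Matrix.continuousOn_dotProduct_left (c : ι → ℝ) {s : Set ℝ} (hX : ContinuousOn X s) :
    ContinuousOn (fun t => c ⬝ᵥ X t) s := by
  unfold dotProduct
  exact continuousOn_finsetSum _ fun j _ => continuousOn_const.mul (continuousOn_pi.1 hX j)

theorem Matrix.hasDerivAt_dotProduct_left (c : ι → ℝ) {X' : ι → ℝ} {t : ℝ}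
    (hX : HasDerivAt X X' t) : HasDerivAt (fun t => c ⬝ᵥ X t) (c ⬝ᵥ X') t := by
  unfold dotProduct
  exact HasDerivAt.fun_sum fun j _ => (hasDerivAt_pi.1 hX j).const_mul _

theorem Matrix.continuousOn_mulVec_left (A : Matrix ι ι ℝ) {s : Set ℝ} (hX : ContinuousOn X s) :
    ContinuousOn (fun t => A *ᵥ X t) s :=
  continuousOn_pi.2 fun i => Matrix.continuousOn_dotProduct_left (A i) hX

variable [DecidableEq ι]

theorem HurwitzMatrix.det_ne_zero (hA : HurwitzMatrix A) {s : ℂ} (hs : 0 ≤ s.re) :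
    (s • (1 : Matrix ι ι ℂ) - A.map Complex.ofReal).det ≠ 0 := by
  intro h
  have hmem : s ∈ spectrum ℂ (A.map Complex.ofReal) := by
    rw [spectrum.mem_iff, Matrix.isUnit_iff_isUnit_det, Algebra.algebraMap_eq_smul_one, h]
    simp
  exact absurd (hA s hmem) (not_lt.2 hs)

theorem Matrix.eq_inv_mulVec_of_mulVec_eq {M : Matrix ι ι ℂ} (hM : M.det ≠ 0) {v w : ι → ℂ}
    (h : M *ᵥ v = w) : v = M⁻¹ *ᵥ w := by
  rw [← h, Matrix.mulVec_mulVec, Matrix.nonsing_inv_mul _ (isUnit_iff_ne_zero.2 hM),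
    Matrix.one_mulVec]

/-- A solution of `X' = A X` whose end values agree up to the factor `e^{iσ(b-a)}` vanishes if no
frequency `σ + 2πk/(b-a)` is a characteristic frequency. -/
theorem eq_zero_of_hasDerivAt_mulVec (hab : a < b) (hX : ContinuousOn X (Icc a b))
    (hd : ∀ t ∈ Ioo a b, HasDerivAt X (A *ᵥ X t) t) {σ : ℝ}
    (h : ∀ i, X a i * Complex.exp (-(Complex.I * σ * a)) =
      X b i * Complex.exp (-(Complex.I * σ * b)))
    (hdet : ∀ k : ℤ, ((Complex.I * (σ + 2 * Real.pi * k / (b - a) : ℝ)) • (1 : Matrix ι ι ℂ) -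
      A.map Complex.ofReal).det ≠ 0) {t : ℝ} (ht : t ∈ Icc a b) : X t = 0 := by
  have hba : (b : ℂ) - a ≠ 0 := by exact_mod_cast (sub_pos.2 hab).ne'
  have hk : ∀ k : ℤ, (fun i => expIntegral a b (Complex.I * (σ + 2 * Real.pi * k / (b - a) : ℝ))
      (fun t => X t i)) = 0 := by
    intro k
    have h1 := mulVec_expIntegral_of_hasDerivAt (B := 0) (u := 0)
      (s := Complex.I * (σ + 2 * Real.pi * k / (b - a) : ℝ)) hab.le hX continuousOn_const
      (fun t ht => by simpa using hd t ht)
    have hexp : ∀ x : ℝ, Complex.exp (-(Complex.I * (σ + 2 * Real.pi * k / (b - a) : ℝ) * x)) =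
        Complex.exp (-(Complex.I * σ * x)) *
          Complex.exp (-(Complex.I * (2 * Real.pi * k / (b - a) : ℝ) * x)) := by
      intro x
      rw [← Complex.exp_add]
      push_cast
      ring_nf
    -- The frequency shift is `(b - a)`-periodic, so the hypothesis at `σ` cancels the boundary
    -- terms for every `k`. The invertible characteristic matrix then annihilates the vector of
    -- coefficients.
    have hper : Complex.exp (-(Complex.I * (2 * Real.pi * k / (b - a) : ℝ) * b)) =
        Complex.exp (-(Complex.I * (2 * Real.pi * k / (b - a) : ℝ) * a)) := by
      rw [Complex.exp_eq_exp_iff_exists_int]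
      refine ⟨-k, ?_⟩
      push_cast
      field_simp
      ring
    have h2 : (fun i => ((0 : ι → ℝ) i : ℂ) *
        expIntegral a b (Complex.I * (σ + 2 * Real.pi * k / (b - a) : ℝ)) 0 +
        X a i * Complex.exp (-(Complex.I * (σ + 2 * Real.pi * k / (b - a) : ℝ) * a)) -
        X b i * Complex.exp (-(Complex.I * (σ + 2 * Real.pi * k / (b - a) : ℝ) * b))) =
        (0 : ι → ℂ) := by
      ext i
      rw [hexp a, hexp b, hper]
      simp only [Pi.zero_apply, Complex.ofReal_zero, zero_mul, zero_add]
      linear_combination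
        Complex.exp (-(Complex.I * (2 * Real.pi * k / (b - a) : ℝ) * a)) * h i
    rw [h2] at h1
    rw [Matrix.eq_inv_mulVec_of_mulVec_eq (hdet k) h1, Matrix.mulVec_zero]
  ext i
  have h3 := hasSum_expIntegral hab (continuousOn_pi.1 hX i)
    (fun t ht => hasDerivAt_pi.1 (hd t ht) i)
    (continuousOn_pi.1 (Matrix.continuousOn_mulVec_left A hX) i) (h i) ht
  have h4 : ∀ k : ℤ, expIntegral a b (Complex.I * (σ + 2 * Real.pi * k / (b - a) : ℝ))
      (fun t => X t i) = 0 := fun k => congrFun (hk k) i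
  simp only [h4, zero_mul] at h3
  have h5 := h3.unique hasSum_zero
  rcases mul_eq_zero.1 h5 with h6 | h6
  · exact absurd h6 hba
  · exact_mod_cast h6

/-- A Hurwitz linear system with a passive scalar jump channel has no nontrivial periodic response
when it is reset once per period at an instant where the trigger `c X` vanishes. -/
theorem eq_zero_of_strictlyPositiveReal (hA : HurwitzMatrix A) {c : ι → ℝ} {q : ι} {β p γ : ℝ}
    (hp : 0 < p) (hγ : γ ∈ Ioc (-1 : ℝ) 1)
    (hspr : StrictlyPositiveReal (fun s =>
      (fun i => ((β * c i + p * (Pi.single q 1 : ι → ℝ) i : ℝ) : ℂ)) ⬝ᵥ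
        ((s • (1 : Matrix ι ι ℂ) - A.map Complex.ofReal)⁻¹ *ᵥ
          (fun i => ((Pi.single q 1 : ι → ℝ) i : ℂ)))))
    (hab : a < b) (hX : ContinuousOn X (Icc a b))
    (hd : ∀ t ∈ Ioo a b, HasDerivAt X (A *ᵥ X t) t)
    (hjump : X a = X b + ((γ - 1) * X b q) • Pi.single q 1)
    (hcq : c q = 0) (hcb : c ⬝ᵥ X b = 0) {t : ℝ} (ht : t ∈ Icc a b) : X t = 0 := by
  obtain ⟨ε, hε, -, hre⟩ := hspr
  have hba0 : 0 < b - a := sub_pos.2 hab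
  have hba : (b : ℂ) - a ≠ 0 := by exact_mod_cast hba0.ne'
  set g : ℝ := (γ - 1) * X b q with hg
  set e : ι → ℝ := Pi.single q 1 with he
  set C₀ : ι → ℝ := fun i => β * c i + p * e i with hC
  set H : ℂ → ℂ := fun s => (fun i => (C₀ i : ℂ)) ⬝ᵥ
        ((s • (1 : Matrix ι ι ℂ) - A.map Complex.ofReal)⁻¹ *ᵥ (fun i => (e i : ℂ))) with hH
  set F : ℝ → ℝ := fun t => C₀ ⬝ᵥ X t with hF
  have hFc : ContinuousOn F (Icc a b) := Matrix.continuousOn_dotProduct_left C₀ hX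
  have hmaps : MapsTo (fun t => a + b - t) (Icc a b) (Icc a b) := fun t ht =>
    ⟨by linarith [ht.2], by linarith [ht.1]⟩
  have hFr : ContinuousOn (fun t => F (a + b - t)) (Icc a b) :=
    hFc.comp (by fun_prop) hmaps
  have hF'c : ContinuousOn (fun t => C₀ ⬝ᵥ (A *ᵥ X t)) (Icc a b) :=
    Matrix.continuousOn_dotProduct_left C₀ (Matrix.continuousOn_mulVec_left A hX)
  have hFd : ∀ t ∈ Ioo a b, HasDerivAt F (C₀ ⬝ᵥ (A *ᵥ X t)) t := fun t ht =>
    Matrix.hasDerivAt_dotProduct_left C₀ (hd t ht)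
  have hper : ∀ k : ℤ, Complex.exp (-(Complex.I * (0 + 2 * Real.pi * k / (b - a) : ℝ) * b)) =
      Complex.exp (-(Complex.I * (0 + 2 * Real.pi * k / (b - a) : ℝ) * a)) := by
    intro k
    rw [Complex.exp_eq_exp_iff_exists_int]
    refine ⟨-k, ?_⟩
    push_cast
    field_simp
    ring
  -- The only boundary contribution is the jump `g e`. Passing it through the resolvent and `C₀`
  -- produces the transfer function `H`.
  have hcoef : ∀ k : ℤ, expIntegral a b (Complex.I * (0 + 2 * Real.pi * k / (b - a) : ℝ)) F *
      Complex.exp (Complex.I * (0 + 2 * Real.pi * k / (b - a) : ℝ) * a) =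
      g * H (Complex.I * (0 + 2 * Real.pi * k / (b - a) : ℝ)) := by
    intro k
    have hpk := hper k
    set s : ℂ := Complex.I * (0 + 2 * Real.pi * k / (b - a) : ℝ) with hs
    have hs0 : 0 ≤ s.re := by rw [hs, Complex.re_mul_ofReal]; simp
    have h1 := mulVec_expIntegral_of_hasDerivAt (B := 0) (u := 0) (s := s)
      hab.le hX continuousOn_const (fun t ht => by simpa using hd t ht)
    have h2 : (fun i => ((0 : ι → ℝ) i : ℂ) * expIntegral a b s 0 +
        X a i * Complex.exp (-(s * a)) - X b i * Complex.exp (-(s * b))) =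
        (g * Complex.exp (-(s * a))) • fun i => (e i : ℂ) := by
      ext i
      rw [hpk, hjump]
      simp only [Pi.zero_apply, Complex.ofReal_zero, zero_mul, zero_add, Pi.add_apply,
        Pi.smul_apply, smul_eq_mul, Complex.ofReal_add, Complex.ofReal_mul]
      ring
    rw [h2] at h1
    have h3 := Matrix.eq_inv_mulVec_of_mulVec_eq (hA.det_ne_zero hs0) h1
    rw [hF, expIntegral_dotProduct hab.le _ hX, h3, Matrix.mulVec_smul, dotProduct_smul,
      smul_eq_mul]
    have h4 : Complex.exp (-(s * a)) * Complex.exp (s * a) = 1 := by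
      rw [← Complex.exp_add, neg_add_cancel, Complex.exp_zero]
    change (g : ℂ) * Complex.exp (-(s * a)) * H s * Complex.exp (s * a) = g * H s
    linear_combination (g * H s) * h4
  -- `F` itself has different end values. Adding its reflection makes them agree, so the series
  -- converges at `a` to `F a + F b`, and conjugate coefficients pair up into real parts of `H`.
  have hsum := hasSum_expIntegral (σ := 0) (f := fun t => F t + F (a + b - t))
    (f' := fun t => C₀ ⬝ᵥ (A *ᵥ X t) - C₀ ⬝ᵥ (A *ᵥ X (a + b - t))) hab (hFc.add hFr)
    (fun t ht => by
      have h1 : a + b - t ∈ Ioo a b := ⟨by linarith [ht.2], by linarith [ht.1]⟩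
      have h2 : HasDerivAt (fun t => a + b - t) (-1) t := by
        simpa using (hasDerivAt_id t).const_sub (a + b)
      have h3 := (hFd _ h1).comp t h2
      rw [mul_neg_one] at h3
      rw [sub_eq_add_neg]
      exact (hFd t ht).add h3)
    (hF'c.sub (hF'c.comp (by fun_prop) hmaps))
    (by simp [add_comm]) (left_mem_Icc.2 hab.le)
  have hterm : ∀ k : ℤ, expIntegral a b (Complex.I * (0 + 2 * Real.pi * k / (b - a) : ℝ))
      (fun t => F t + F (a + b - t)) *
      Complex.exp (Complex.I * (0 + 2 * Real.pi * k / (b - a) : ℝ) * a) =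
      ((2 * g * (H (Complex.I * (0 + 2 * Real.pi * k / (b - a) : ℝ))).re : ℝ) : ℂ) := by
    intro k
    have h1 := hcoef k
    have h2 := expIntegral_conj (a := a) (b := b) (f := F) (0 + 2 * Real.pi * k / (b - a))
    have hpk := hper k
    have h5 : (starRingEnd ℂ)
        (Complex.exp (Complex.I * (0 + 2 * Real.pi * k / (b - a) : ℝ) * a)) =
        Complex.exp (-(Complex.I * (0 + 2 * Real.pi * k / (b - a) : ℝ) * a)) := by
      rw [← Complex.exp_conj]
      simp only [map_mul, Complex.conj_I, Complex.conj_ofReal, neg_mul]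
    set s : ℂ := Complex.I * (0 + 2 * Real.pi * k / (b - a) : ℝ) with hs
    rw [expIntegral_add hab.le hFc hFr, expIntegral_reflect, add_mul, h1, h2]
    have h4 : Complex.exp (-(s * (a + b : ℝ))) * Complex.exp (s * a) =
        Complex.exp (-(s * a)) := by
      rw [← hpk, ← Complex.exp_add]
      push_cast
      ring_nf
    have h6 : Complex.exp (-(s * (a + b : ℝ))) * (starRingEnd ℂ) (expIntegral a b s F) *
        Complex.exp (s * a) = (starRingEnd ℂ) (g * H s) := by
      rw [← h1, map_mul, h5, ← h4]
      ring
    rw [h6, Complex.add_conj, Complex.re_ofReal_mul]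
    push_cast
    ring
  simp only [hterm] at hsum
  have hsum' := (Complex.hasSum_iff _ _).1 hsum |>.1
  simp only [Complex.ofReal_re] at hsum'
  have hval : (((b : ℂ) - a) * ((F a + F (a + b - a) : ℝ) : ℂ)).re = (b - a) * (F a + F b) := by
    rw [add_sub_cancel_left, ← Complex.ofReal_sub, ← Complex.ofReal_mul, Complex.ofReal_re]
  rw [hval] at hsum'
  have hnn : 0 ≤ g * ((b - a) * (F a + F b)) := by
    refine (hsum'.mul_left g).nonneg fun k => ?_
    have h1 := hre (Complex.I * (0 + 2 * Real.pi * k / (b - a) : ℝ))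
      (by rw [Complex.re_mul_ofReal]; simpa using hε)
    have h2 : g * (2 * g * (H (Complex.I * (0 + 2 * Real.pi * k / (b - a) : ℝ))).re) =
        2 * g ^ 2 * (H (Complex.I * (0 + 2 * Real.pi * k / (b - a) : ℝ))).re := by ring
    rw [h2]
    exact mul_nonneg (by positivity) h1
  -- The trigger vanishes at `b`, which removes the `β` term; `c q = 0` removes it from the jump of
  -- `F` below.
  have hFb : F b = p * X b q := by
    have : F b = β * (c ⬝ᵥ X b) + p * (e ⬝ᵥ X b) := by
      simp only [hF, hC, dotProduct, Finset.mul_sum, ← Finset.sum_add_distrib]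
      exact Finset.sum_congr rfl fun i _ => by ring
    rw [this, hcb, he, single_one_dotProduct]
    ring
  have hFa : F a = F b + g * p := by
    have h1 : C₀ ⬝ᵥ e = p := by
      rw [he, dotProduct_single_one, hC]
      simp [hcq, he]
    simp only [hF]
    rw [hjump, dotProduct_add, dotProduct_smul, h1, smul_eq_mul]
  have hg0 : g = 0 := by
    rw [hFa, hFb, hg] at hnn
    -- The same quantity that positive realness makes nonnegative is nonpositive for `-1 < γ ≤ 1`,
    -- so the jump is zero.
    have h1 : (γ - 1) * X b q * ((b - a) * (p * X b q + (γ - 1) * X b q * p + p * X b q)) =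
        -((b - a) * p * (1 - γ) * (1 + γ) * X b q ^ 2) := by ring
    rw [h1] at hnn
    by_cases hγ1 : γ = 1
    · simp [hg, hγ1]
    · have h2 : 0 < 1 - γ := by
        have := lt_of_le_of_ne hγ.2 hγ1
        linarith
      have h3 : 0 < 1 + γ := by linarith [hγ.1]
      have h4 : 0 < (b - a) * p * (1 - γ) * (1 + γ) := by positivity
      have h5 : X b q ^ 2 = 0 := by
        refine le_antisymm ?_ (sq_nonneg _)
        by_contra h6
        have := mul_pos h4 (not_le.1 h6)
        linarith
      rw [hg, pow_eq_zero_iff (by norm_num)] at *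
      rw [h5, mul_zero]
  -- Without a jump, `X` is a genuinely periodic solution, and a Hurwitz matrix has no imaginary
  -- eigenvalue.
  refine eq_zero_of_hasDerivAt_mulVec (σ := 0) hab hX hd (fun i => ?_) (fun k => ?_) ht
  · rw [hjump, hg0]
    simp
  · exact hA.det_ne_zero (by rw [Complex.re_mul_ofReal]; simp)

theorem Matrix.hasDerivAt_exp_smul_mulVec (A : Matrix ι ι ℝ) (v : ι → ℝ) (a t : ℝ) :
    HasDerivAt (fun t : ℝ => NormedSpace.exp ((t - a) • A) *ᵥ v)
      (A *ᵥ (NormedSpace.exp ((t - a) • A) *ᵥ v)) t := by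
  let _ : NormedRing (Matrix ι ι ℝ) := Matrix.linftyOpNormedRing
  let _ : NormedAlgebra ℝ (Matrix ι ι ℝ) := Matrix.linftyOpNormedAlgebra
  have h1 := hasDerivAt_exp_smul_const' (𝕂 := ℝ) A (t - a)
  have h2 : HasDerivAt (fun t : ℝ => t - a) 1 t := (hasDerivAt_id t).sub_const a
  have h3 := h1.scomp t h2
  rw [one_smul] at h3
  let L : Matrix ι ι ℝ →ₗ[ℝ] (ι → ℝ) := (Matrix.mulVecBilin ℝ ℝ).flip v
  have h4 := (LinearMap.toContinuousLinearMap L).hasFDerivAt.comp_hasDerivAt t h3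
  rw [Matrix.mulVec_mulVec]
  exact h4

/-- If no odd multiple of `ω` is a characteristic frequency of `A` then `-1` is not an eigenvalue
of `e^{Aπ/ω}`. -/
theorem Matrix.det_one_add_exp_ne_zero (A : Matrix ι ι ℝ) {ω : ℝ} (hω : 0 < ω)
    (hdet : ∀ k : ℤ, ((Complex.I * (ω + 2 * ω * k : ℝ)) • (1 : Matrix ι ι ℂ) -
      A.map Complex.ofReal).det ≠ 0) :
    (1 + NormedSpace.exp ((Real.pi / ω) • A)).det ≠ 0 := by
  intro h
  obtain ⟨v, hv, hv0⟩ := Matrix.exists_mulVec_eq_zero_iff.2 h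
  refine hv ?_
  have hd := Matrix.hasDerivAt_exp_smul_mulVec A v 0
  have hpos : 0 < Real.pi / ω := div_pos Real.pi_pos hω
  have h0 : NormedSpace.exp (((0 : ℝ) - 0) • A) *ᵥ v = v := by
    rw [sub_zero, zero_smul, NormedSpace.exp_zero, Matrix.one_mulVec]
  -- A kernel vector `v` starts a trajectory `e^{tA} v` that changes sign over `π/ω`. The twist `σ =
  -- ω` encodes this sign and leaves only odd multiples of `ω` as possible frequencies.
  have hfin := eq_zero_of_hasDerivAt_mulVec (σ := ω) hpos
    (fun t _ => (hd t).continuousAt.continuousWithinAt) (fun t _ => hd t) (fun i => ?_)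
    (fun k => ?_) (left_mem_Icc.2 hpos.le)
  · rwa [h0] at hfin
  · rw [h0, sub_zero]
    rw [Matrix.add_mulVec, Matrix.one_mulVec] at hv0
    rw [← neg_eq_of_add_eq_zero_right hv0]
    have : Complex.exp (-(Complex.I * ω * (Real.pi / ω : ℝ))) = -1 := by
      have hω' : (ω : ℂ) ≠ 0 := by exact_mod_cast hω.ne'
      have : -(Complex.I * ω * (Real.pi / ω : ℝ)) = -(Real.pi * Complex.I) := by
        push_cast
        field_simp
      rw [this, Complex.exp_neg, Complex.exp_pi_mul_I]
      norm_num
    rw [this]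
    simp
  · have : ω + 2 * Real.pi * k / (Real.pi / ω - 0) = ω + 2 * ω * k := by
      have := Real.pi_pos
      field_simp
      ring
    rw [this]
    exact hdet k

end LinearODE

/-! ### Phasors -/

section Phasor

theorem cexp_neg_I_mul_nat_mul_pi (n : ℕ) : Complex.exp (-(Complex.I * (n * Real.pi : ℝ))) = (-1) ^ n := by
  have : -(Complex.I * (n * Real.pi : ℝ)) = (n : ℂ) * (-(Real.pi * Complex.I)) := by
    push_cast
    ring
  rw [this, Complex.exp_nat_mul, Complex.exp_neg, Complex.exp_pi_mul_I]
  norm_num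

/-- The phasors of a half-wave antisymmetric signal as integrals over half a period. -/
theorem phasor_of_antiperiodic {ω : ℝ} (hω : 0 < ω) {f g : ℝ → ℝ} {a b : ℝ}
    (hb : b = a + Real.pi / ω) (hf : ∀ t, f (t + Real.pi / ω) = -f t)
    (hg : ContinuousOn g (Icc a b)) (hfg : ∀ t ∈ Ioc a b, f t = g t) (n : ℕ) :
    phasor ω n f = (1 - (-1) ^ n) * Complex.I * (ω / Real.pi) *
      expIntegral a b (Complex.I * (n * ω : ℝ)) g := by
  have hpos : 0 < Real.pi / ω := div_pos Real.pi_pos hω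
  have hab : a ≤ b := by linarith
  set G : ℝ → ℂ := fun t => (f t : ℂ) * Complex.exp (-(Complex.I * ((n * ω * t : ℝ) : ℂ))) with hG
  -- Hence the second half period contributes `-(-1)ⁿ` times the first: they cancel for even `n` and
  -- add for odd `n`.
  have hGh : ∀ t, G (t + Real.pi / ω) = -(-1) ^ n * G t := by
    intro t
    have h1 : -(Complex.I * ((n * ω * (t + Real.pi / ω) : ℝ) : ℂ)) =
        -(Complex.I * ((n * ω * t : ℝ) : ℂ)) + -(Complex.I * (n * Real.pi : ℝ)) := by
      have : (n * ω * (t + Real.pi / ω) : ℝ) = n * ω * t + n * Real.pi := by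
        field_simp
      rw [this]
      push_cast
      ring
    simp only [hG]
    rw [hf, h1, Complex.exp_add, cexp_neg_I_mul_nat_mul_pi]
    push_cast
    ring
  have hper : Function.Periodic G (2 * Real.pi / ω) := by
    intro t
    have h1 : t + 2 * Real.pi / ω = t + Real.pi / ω + Real.pi / ω := by ring
    have h2 : ((-1 : ℂ) ^ n) * (-1) ^ n = 1 := by rw [← mul_pow]; norm_num
    rw [h1, hGh, hGh]
    linear_combination G t * h2
  have hint : IntervalIntegrable G volume a b := by
    refine (intervalIntegrable_mul_cexp hab hg (Complex.I * (n * ω : ℝ))).congr ?_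
    intro t ht
    rw [uIoc_of_le hab] at ht
    simp only [hG]
    rw [hfg t ht]
    push_cast
    ring_nf
  have hval : ∫ t in a..b, G t = expIntegral a b (Complex.I * (n * ω : ℝ)) g := by
    rw [← expIntegral_congr hab hfg]
    unfold expIntegral
    congr 1
    ext t
    simp only [hG]
    push_cast
    ring_nf
  have hint2 : IntervalIntegrable G volume b (b + Real.pi / ω) := by
    have h1 := (hint.const_mul (-(-1) ^ n)).comp_sub_right (Real.pi / ω)
    rw [← hb] at h1
    refine h1.congr ?_
    intro t _
    simp only
    rw [← hGh, sub_add_cancel]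
  have hval2 : ∫ t in b..(b + Real.pi / ω), G t = -(-1) ^ n * ∫ t in a..b, G t := by
    rw [← intervalIntegral.integral_const_mul]
    have h1 := intervalIntegral.integral_comp_add_right (a := a) (b := b) G (Real.pi / ω)
    rw [← hb] at h1
    rw [← h1]
    simp only [hGh]
  unfold phasor
  have h3 := hper.intervalIntegral_add_eq 0 a
  rw [zero_add] at h3
  have h4 : a + 2 * Real.pi / ω = b + Real.pi / ω := by rw [hb]; ring
  change 2 * Complex.I * ((ω / (2 * Real.pi) : ℝ) : ℂ) * ∫ t in (0 : ℝ)..(2 * Real.pi / ω), G t = _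
  rw [h3, h4, ← intervalIntegral.integral_add_adjacent_intervals hint hint2, hval2, hval]
  push_cast
  field_simp
  ring

theorem integral_cexp_period {ω : ℝ} (hω : 0 < ω) (k : ℤ) :
    ∫ t in (0 : ℝ)..(2 * Real.pi / ω), Complex.exp (Complex.I * (k * ω : ℝ) * t) =
      if k = 0 then ((2 * Real.pi / ω : ℝ) : ℂ) else 0 := by
  split_ifs with hk
  · subst hk
    simp
  · have hω' : (ω : ℂ) ≠ 0 := by exact_mod_cast hω.ne'
    have hk' : (k : ℂ) ≠ 0 := by exact_mod_cast hk
    rw [integral_exp_mul_complex (by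
      push_cast
      exact mul_ne_zero Complex.I_ne_zero (mul_ne_zero hk' hω'))]
    have : Complex.I * (k * ω : ℝ) * ((2 * Real.pi / ω : ℝ) : ℂ) =
        (k : ℂ) * (2 * Real.pi * Complex.I) := by
      push_cast
      field_simp
    rw [this, Complex.exp_int_mul_two_pi_mul_I]
    simp

theorem phasor_sin {ω : ℝ} (hω : 0 < ω) (R : ℝ) {m n : ℕ} (hm : 1 ≤ m) :
    phasor ω n (fun t => R * Real.sin (m * ω * t)) = if n = m then (R : ℂ) else 0 := by
  have hω' : (ω : ℂ) ≠ 0 := by exact_mod_cast hω.ne'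
  have hπ : (Real.pi : ℂ) ≠ 0 := by exact_mod_cast Real.pi_pos.ne'
  unfold phasor
  have h1 : ∀ t : ℝ, ((R * Real.sin (m * ω * t) : ℝ) : ℂ) *
      Complex.exp (-(Complex.I * ((n * ω * t : ℝ) : ℂ))) =
      R / (2 * Complex.I) * (Complex.exp (Complex.I * (((m : ℤ) - n : ℤ) * ω : ℝ) * t) -
        Complex.exp (Complex.I * ((-((m : ℤ) + n) : ℤ) * ω : ℝ) * t)) := by
    intro t
    have e1 : Complex.exp (Complex.I * (((m : ℤ) - n : ℤ) * ω : ℝ) * t) =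
        Complex.exp ((m * ω * t : ℂ) * Complex.I) *
          Complex.exp (-(Complex.I * ((n * ω * t : ℝ) : ℂ))) := by
      rw [← Complex.exp_add]
      push_cast
      ring_nf
    have e2 : Complex.exp (Complex.I * ((-((m : ℤ) + n) : ℤ) * ω : ℝ) * t) =
        Complex.exp (-(m * ω * t : ℂ) * Complex.I) *
          Complex.exp (-(Complex.I * ((n * ω * t : ℝ) : ℂ))) := by
      rw [← Complex.exp_add]
      push_cast
      ring_nf
    rw [e1, e2, Complex.ofReal_mul, Complex.ofReal_sin, Complex.sin]
    have hI := Complex.I_mul_I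
    push_cast
    field_simp
    linear_combination R * (Complex.exp (-(m * ω * t * Complex.I)) -
      Complex.exp (m * ω * t * Complex.I)) * hI
  simp only [h1]
  rw [intervalIntegral.integral_const_mul, intervalIntegral.integral_sub,
    integral_cexp_period hω, integral_cexp_period hω, if_neg (by omega : ¬ -((m : ℤ) + n) = 0)]
  · by_cases hnm : n = m
    · rw [if_pos (by omega), if_pos hnm]
      push_cast
      field_simp
      ring
    · rw [if_neg (by omega), if_neg hnm]
      simp
  · exact Continuous.intervalIntegrable (by fun_prop) _ _
  · exact Continuous.intervalIntegrable (by fun_prop) _ _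

end Phasor

/-! ### The algebra of the block diagram -/

namespace ResetLoop

variable (S : ResetLoop)

/-- Contribution of the state of block `b` to its output. -/
def stateOut (x : S.Idx → ℝ) (b : Block) : ℝ := (S.sys b).C ⬝ᵥ fun i => x ⟨b, i⟩

/-- The output of `C1` when the algebraic loop is open. -/
def solveZ (x : S.Idx → ℝ) (r : ℝ) : ℝ :=
  S.stateOut x Block.C1 + (S.sys Block.C1).D * (r - S.stateOut x Block.C4 -
    (S.sys Block.C4).D * (S.stateOut x Block.P + (S.sys Block.P).D * S.stateOut x Block.C3))

/-- The input of `C3` when the algebraic loop is open. -/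
def solveV (x : S.Idx → ℝ) (r : ℝ) : ℝ :=
  S.stateOut x Block.Cr + (S.sys Block.Cr).D * S.solveZ x r +
    (S.stateOut x Block.C2 + (S.sys Block.C2).D * S.solveZ x r)

/-- The control input when the algebraic loop is open. -/
def solveU (x : S.Idx → ℝ) (r : ℝ) : ℝ :=
  S.stateOut x Block.C3 + (S.sys Block.C3).D * S.solveV x r

/-- The plant output when the algebraic loop is open. -/
def solveY (x : S.Idx → ℝ) (r : ℝ) : ℝ :=
  S.stateOut x Block.P + (S.sys Block.P).D * S.solveU x r

/-- The solution of the block diagram when there is no direct feedthrough around the loop. -/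
def solve (x : S.Idx → ℝ) (r : ℝ) : Block → ℝ
  | Block.Cr => S.solveZ x r
  | Block.C1 => r - (S.stateOut x Block.C4 + (S.sys Block.C4).D * S.solveY x r)
  | Block.C2 => S.solveZ x r
  | Block.C3 => S.solveV x r
  | Block.C4 => S.solveY x r
  | Block.Cs => S.solveZ x r
  | Block.P => S.solveU x r

variable {S}

/-- Substituting around the loop leaves the input of `C3` multiplied by the product of the four
feedthroughs, which is zero. The output of `C1` is therefore explicit, and the other signals follow
in turn. -/
theorem Diagram.eq_solve (hproper : (S.sys Block.C1).D * (S.sys Block.C3).D * (S.sys Block.P).D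
      * (S.sys Block.C4).D = 0) {x : S.Idx → ℝ} {r : ℝ} {inp : Block → ℝ}
    (h : S.Diagram x r inp) : inp = S.solve x r := by
  obtain ⟨he, hzr, hz2, hzs, hv, hu, hy⟩ := h
  have hout : ∀ b, S.out x inp b = S.stateOut x b + (S.sys b).D * inp b := fun b => rfl
  rw [hout] at he hzr hz2 hzs hu hy
  rw [hout, hout] at hv
  have hz : S.stateOut x Block.C1 + (S.sys Block.C1).D * inp Block.C1 = S.solveZ x r := by
    unfold solveZ
    linear_combination (S.sys Block.C1).D * he -
      (S.sys Block.C1).D * (S.sys Block.C4).D * hy -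
      (S.sys Block.C1).D * (S.sys Block.C4).D * (S.sys Block.P).D * hu - inp Block.C3 * hproper
  rw [hz] at hzr hz2 hzs
  have hv' : inp Block.C3 = S.solveV x r := by rw [hv, hzr, hz2]; rfl
  have hu' : inp Block.P = S.solveU x r := by rw [hu, hv']; rfl
  have hy' : inp Block.C4 = S.solveY x r := by rw [hy, hu']; rfl
  have he' : inp Block.C1 = S.solve x r Block.C1 := by rw [he, hy']; rfl
  ext b
  cases b
  exacts [hzr, he', hz2, hv', hy', hzs, hu']

theorem diagram_solve (hproper : (S.sys Block.C1).D * (S.sys Block.C3).D * (S.sys Block.P).D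
      * (S.sys Block.C4).D = 0) (x : S.Idx → ℝ) (r : ℝ) : S.Diagram x r (S.solve x r) := by
  have hz : S.solveZ x r = S.out x (S.solve x r) Block.C1 := by
    change _ = S.stateOut x Block.C1 + (S.sys Block.C1).D *
      (r - (S.stateOut x Block.C4 + (S.sys Block.C4).D * (S.stateOut x Block.P +
        (S.sys Block.P).D * (S.stateOut x Block.C3 + (S.sys Block.C3).D * S.solveV x r))))
    unfold solveZ
    linear_combination S.solveV x r * hproper
  exact ⟨rfl, hz, hz, hz, rfl, rfl, rfl⟩

theorem out_add (x y : S.Idx → ℝ) (i j : Block → ℝ) (b : Block) :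
    S.out (x + y) (i + j) b = S.out x i b + S.out y j b := by
  have : (fun k => (x + y) ⟨b, k⟩) = (fun k => x ⟨b, k⟩) + fun k => y ⟨b, k⟩ := rfl
  unfold out
  rw [this, dotProduct_add, Pi.add_apply]
  ring

theorem Diagram.add {x y : S.Idx → ℝ} {r s : ℝ} {i j : Block → ℝ} (h : S.Diagram x r i)
    (h' : S.Diagram y s j) : S.Diagram (x + y) (r + s) (i + j) := by
  constructor <;> simp only [out_add, Pi.add_apply]
  · rw [h.e_eq, h'.e_eq]; ring
  · rw [h.zr_eq, h'.zr_eq]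
  · rw [h.z2_eq, h'.z2_eq]
  · rw [h.zs_eq, h'.zs_eq]
  · rw [h.v_eq, h'.v_eq]; ring
  · rw [h.u_eq, h'.u_eq]
  · rw [h.y_eq, h'.y_eq]

theorem field_add (x y : S.Idx → ℝ) (i j : Block → ℝ) :
    S.field (x + y) (i + j) = S.field x i + S.field y j := by
  ext q
  have : (fun k => (x + y) ⟨q.1, k⟩) = (fun k => x ⟨q.1, k⟩) + fun k => y ⟨q.1, k⟩ := rfl
  unfold field
  rw [this, Matrix.mulVec_add]
  simp only [Pi.add_apply]
  ring

theorem Arho_mulVec (v : Fin (S.sys Block.Cr).order → ℝ) :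
    S.Arho *ᵥ v = v + ((S.γ - 1) * v S.rho) • Pi.single S.rho 1 := by
  ext i
  unfold Arho
  rw [Matrix.mulVec_diagonal]
  by_cases h : i = S.rho
  · subst h
    simp
    ring
  · simp [h]

theorem jump_eq (x : S.Idx → ℝ) :
    S.jump x = x + ((S.γ - 1) * x ⟨Block.Cr, S.rho⟩) • S.eRho := by
  ext ⟨b, i⟩
  cases b
  case Cr =>
    change (S.Arho *ᵥ (fun k => x ⟨Block.Cr, k⟩)) i = _
    rw [Arho_mulVec]
    by_cases h : i = S.rho
    · subst h
      simp [eRho]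
    · have : (⟨Block.Cr, i⟩ : S.Idx) ≠ ⟨Block.Cr, S.rho⟩ := by
        simpa using h
      simp [eRho, h, this]
  all_goals
    simp [jump, eRho]

theorem jump_add (x y : S.Idx → ℝ) : S.jump (x + y) = S.jump x + S.jump y := by
  ext q
  simp only [jump_eq, Pi.add_apply, Pi.smul_apply, smul_eq_mul]
  ring

theorem stateOut_eRho {b : Block} (hb : b ≠ Block.Cr) : S.stateOut S.eRho b = 0 := by
  have : (fun i => S.eRho ⟨b, i⟩) = 0 := by
    ext i
    unfold eRho
    rw [Pi.single_eq_of_ne]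
    · rfl
    · intro h
      exact hb (congrArg Sigma.fst h)
  unfold stateOut
  rw [this, dotProduct_zero]

/-- The reset state could affect `z` instantaneously only through the feedthroughs of `C3`, `P`,
`C4` and `C1`, whose product vanishes. So a reset does not make `z_s` jump. -/
theorem IsBaseLinear.czs_rho (hproper : (S.sys Block.C1).D * (S.sys Block.C3).D *
      (S.sys Block.P).D * (S.sys Block.C4).D = 0) {Acl : Matrix S.Idx S.Idx ℝ} {czs : S.Idx → ℝ}
    (h : S.IsBaseLinear Acl czs) : czs ⟨Block.Cr, S.rho⟩ = 0 := by
  have h1 := (h _ _ (diagram_solve hproper S.eRho 0)).2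
  have h2 : czs ⬝ᵥ S.eRho = czs ⟨Block.Cr, S.rho⟩ := by
    unfold eRho
    rw [dotProduct_single_one]
  rw [← h2, ← h1]
  change S.stateOut S.eRho Block.Cs + (S.sys Block.Cs).D * S.solveZ S.eRho 0 = 0
  simp [solveZ, stateOut_eRho]

theorem continuousOn_stateOut {s : Set ℝ} {X : ℝ → S.Idx → ℝ} (hX : ContinuousOn X s) (b : Block) :
    ContinuousOn (fun t => S.stateOut (X t) b) s :=
  Matrix.continuousOn_dotProduct_left _
    (continuousOn_pi.2 fun _ => continuousOn_pi.1 hX _)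

theorem continuousOn_solve {s : Set ℝ} {X : ℝ → S.Idx → ℝ} (hX : ContinuousOn X s) {r : ℝ → ℝ}
    (hr : ContinuousOn r s) (b : Block) : ContinuousOn (fun t => S.solve (X t) (r t) b) s := by
  have h := continuousOn_stateOut hX
  have hC1 := h Block.C1
  have hC2 := h Block.C2
  have hC3 := h Block.C3
  have hC4 := h Block.C4
  have hCr := h Block.Cr
  have hP := h Block.P
  cases b <;> simp only [solve, solveZ, solveV, solveU, solveY] <;> fun_prop

end ResetLoop

/-! ### Half-wave antisymmetry of the steady state -/

/-- At a reset the trajectory stores the value before the jump. Replacing it by the right limit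
gives a continuous arc on the closed interval between two resets. -/
theorem continuousOn_update_Icc {E : Type*} [TopologicalSpace E] {x : ℝ → E}
    {v : E} {a b : ℝ} (ha : Tendsto x (𝓝[>] a) (𝓝 v))
    (hc : ∀ t ∈ Ioo a b, ContinuousAt x t) (hb : ContinuousWithinAt x (Iic b) b) :
    ContinuousOn (Function.update x a v) (Icc a b) := by
  rw [continuousOn_update_iff]
  have hsub : Icc a b \ {a} ⊆ Ioc a b := fun t ht => ⟨lt_of_le_of_ne ht.1.1 (Ne.symm ht.2), ht.1.2⟩
  refine ⟨fun t ht => ?_, fun _ => ?_⟩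
  · have ht' := hsub ht
    rcases eq_or_lt_of_le ht'.2 with rfl | hlt
    · exact hb.mono fun y hy => hy.1.2
    · exact (hc t ⟨ht'.1, hlt⟩).continuousWithinAt
  · exact ha.mono_left (nhdsWithin_mono _ fun t ht => (hsub ht).1)

namespace ResetLoop

variable {S : ResetLoop} {ω R : ℝ} {x : ℝ → S.Idx → ℝ} {inp : ℝ → Block → ℝ}

/-- The phase of the first harmonic of the trigger signal. -/
noncomputable def trigPhase (S : ResetLoop) (ω : ℝ) (x : ℝ → S.Idx → ℝ) (inp : ℝ → Block → ℝ) : ℝ :=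
  (phasor ω 1 (S.trigger x inp)).arg

/-- A reset instant at which the first harmonic of the trigger signal is increasing. -/
noncomputable def resetTime (S : ResetLoop) (ω : ℝ) (x : ℝ → S.Idx → ℝ) (inp : ℝ → Block → ℝ) : ℝ :=
  -S.trigPhase ω x inp / ω

theorem IsTwoReset.trigger_eq_zero_iff (htwo : S.IsTwoReset ω x inp) (t : ℝ) :
    S.trigger x inp t = 0 ↔ Real.sin (ω * t + S.trigPhase ω x inp) = 0 := by
  rw [htwo.zeros, mul_eq_zero, norm_eq_zero, or_iff_right htwo.first_ne_zero]
  rfl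

theorem IsTwoReset.mem_add_iff (hω : 0 < ω) (htwo : S.IsTwoReset ω x inp) (t : ℝ) :
    t + Real.pi / ω ∈ S.resetInstants x inp ↔ t ∈ S.resetInstants x inp := by
  simp only [resetInstants, mem_ofPred_eq, htwo.trigger_eq_zero_iff]
  have : ω * (t + Real.pi / ω) + S.trigPhase ω x inp =
      ω * t + S.trigPhase ω x inp + Real.pi := by
    field_simp
    ring
  rw [this, Real.sin_add_pi, neg_eq_zero]

theorem IsTwoReset.resetTime_mem (hω : 0 < ω) (htwo : S.IsTwoReset ω x inp) :
    S.resetTime ω x inp ∈ S.resetInstants x inp := by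
  simp only [resetInstants, mem_ofPred_eq, htwo.trigger_eq_zero_iff, resetTime]
  rw [mul_div_cancel₀ _ hω.ne', neg_add_cancel, Real.sin_zero]

theorem IsTwoReset.not_mem (hω : 0 < ω) (htwo : S.IsTwoReset ω x inp) {t : ℝ}
    (ht : t ∈ Ioo (S.resetTime ω x inp) (S.resetTime ω x inp + Real.pi / ω)) :
    t ∉ S.resetInstants x inp := by
  simp only [resetInstants, mem_ofPred_eq, htwo.trigger_eq_zero_iff]
  have h1 : 0 < ω * t + S.trigPhase ω x inp := by
    have := mul_lt_mul_of_pos_left ht.1 hω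
    rw [resetTime, mul_div_cancel₀ _ hω.ne'] at this
    linarith
  have h2 : ω * t + S.trigPhase ω x inp < Real.pi := by
    have := mul_lt_mul_of_pos_left ht.2 hω
    rw [resetTime, mul_add, mul_div_cancel₀ _ hω.ne', mul_div_cancel₀ _ hω.ne'] at this
    linarith
  exact (Real.sin_pos_of_pos_of_lt_pi h1 h2).ne'

theorem sin_add_half_period (hω : 0 < ω) (R t : ℝ) :
    R * Real.sin (ω * (t + Real.pi / ω)) = -(R * Real.sin (ω * t)) := by
  rw [mul_add, mul_div_cancel₀ _ hω.ne', Real.sin_add_pi, mul_neg]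

/-- The steady state is half-wave antisymmetric. -/
theorem IsSteadyState.add_half_period (hω : 0 < ω)
    (hproper : (S.sys Block.C1).D * (S.sys Block.C3).D * (S.sys Block.P).D
      * (S.sys Block.C4).D = 0) (hβ : S.HBeta) (hss : S.IsSteadyState ω R x inp)
    (htwo : S.IsTwoReset ω x inp) (t : ℝ) : x (t + Real.pi / ω) = -x t := by
  obtain ⟨Acl, czs, β, p, hbl, hA, hp, hspr⟩ := hβ
  set h := Real.pi / ω with hh
  have hpos : 0 < h := div_pos Real.pi_pos hω
  set a := S.resetTime ω x inp with ha
  have h2h : ∀ t, x (t + h + h) = x t := fun t => by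
    have := hss.periodic t
    rwa [show t + 2 * Real.pi / ω = t + h + h by rw [hh]; ring] at this
  -- The reference changes sign over `h`, so it cancels in `w`. The reset set is `h`-periodic and
  -- the jump is linear, so both summands reset together and `w` obeys the same reset law.
  set w : ℝ → S.Idx → ℝ := fun t => x t + x (t + h) with hw
  have hdiag : ∀ t, S.Diagram (w t) 0 (inp t + inp (t + h)) := fun t => by
    have := (hss.diagram t).add (hss.diagram (t + h))
    rwa [sin_add_half_period hω, add_neg_cancel] at this
  have hmem : a ∈ S.resetInstants x inp := htwo.resetTime_mem hω
  have hmem1 : a + h ∈ S.resetInstants x inp := (htwo.mem_add_iff hω a).2 hmem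
  have hmem2 : a + h + h ∈ S.resetInstants x inp := (htwo.mem_add_iff hω _).2 hmem1
  have hder : ∀ t ∈ Ioo a (a + h), HasDerivAt w (Acl *ᵥ w t) t := by
    intro t ht
    have h1 : t ∉ S.resetInstants x inp := htwo.not_mem hω ht
    have h2 : t + h ∉ S.resetInstants x inp := fun h' => h1 ((htwo.mem_add_iff hω t).1 h')
    rw [← (hbl _ _ (hdiag t)).1, field_add]
    exact (hss.flow t h1).add ((hss.flow _ h2).comp_add_const t h)
  have hright : Tendsto w (𝓝[>] a) (𝓝 (S.jump (w a))) := by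
    rw [hw, jump_add]
    refine (hss.reset a hmem).add ((hss.reset (a + h) hmem1).comp ?_)
    refine tendsto_nhdsWithin_of_tendsto_nhds_of_eventually_within _ ?_ ?_
    · exact (tendsto_id.add_const h).mono_left nhdsWithin_le_nhds
    · filter_upwards [self_mem_nhdsWithin] with t ht
      exact add_lt_add_left ht h
  have hleft : ContinuousWithinAt w (Iic (a + h)) (a + h) := by
    refine (hss.left_cont _ hmem1).add ?_
    exact ContinuousWithinAt.comp (f := fun t => t + h) (t := Iic (a + h + h))
      (hss.left_cont _ hmem2) (by fun_prop) fun t ht => add_le_add_left ht h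
  have hcont := continuousOn_update_Icc hright (fun t ht => (hder t ht).continuousAt) hleft
  have hwper : Function.Periodic w h := fun t => by
    simp only [hw]
    rw [h2h, add_comm]
  have hne : ∀ t, a < t → Function.update w a (S.jump (w a)) t = w t := fun t ht =>
    Function.update_of_ne ht.ne' _ _
  have hzero : ∀ t ∈ Ioc a (a + h), w t = 0 := by
    intro t ht
    rw [← hne t ht.1]
    refine eq_zero_of_strictlyPositiveReal hA hp S.γ_mem hspr (by linarith : a < a + h) hcont
      (fun t ht => ?_) ?_ (hbl.czs_rho hproper) ?_ (Ioc_subset_Icc_self ht)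
    · rw [hne t ht.1]
      refine (hder t ht).congr_of_eventuallyEq ?_
      filter_upwards [lt_mem_nhds ht.1] with y hy using hne y hy
    · rw [hne (a + h) (by linarith), Function.update_self, hwper, jump_eq]
      rfl
    · rw [hne (a + h) (by linarith), ← (hbl _ _ (hdiag _)).2, out_add]
      have e1 : S.trigger x inp (a + h) = 0 := hmem1
      have e2 : S.trigger x inp (a + h + h) = 0 := hmem2
      unfold trigger at e1 e2
      rw [e1, e2, add_zero]
  obtain ⟨k, hk, -⟩ := existsUnique_add_zsmul_mem_Ioc hpos t a
  have hwt : w t = 0 := by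
    rw [← hzero _ hk]
    exact ((hwper.zsmul k) t).symm
  exact eq_neg_of_add_eq_zero_right hwt

theorem Diagram.neg {y : S.Idx → ℝ} {r : ℝ} {i : Block → ℝ} (h : S.Diagram y r i) :
    S.Diagram (-y) (-r) (-i) := by
  have hout : ∀ b, S.out (-y) (-i) b = -S.out y i b := by
    intro b
    have : (fun k => (-y) ⟨b, k⟩) = -fun k => y ⟨b, k⟩ := rfl
    unfold out
    rw [this, dotProduct_neg, Pi.neg_apply]
    ring
  constructor <;> simp only [hout, Pi.neg_apply]
  · rw [h.e_eq]; ring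
  · rw [h.zr_eq]
  · rw [h.z2_eq]
  · rw [h.zs_eq]
  · rw [h.v_eq]; ring
  · rw [h.u_eq]
  · rw [h.y_eq]

theorem IsSteadyState.inp_add_half_period (hω : 0 < ω)
    (hproper : (S.sys Block.C1).D * (S.sys Block.C3).D * (S.sys Block.P).D
      * (S.sys Block.C4).D = 0) (hβ : S.HBeta) (hss : S.IsSteadyState ω R x inp)
    (htwo : S.IsTwoReset ω x inp) (t : ℝ) : inp (t + Real.pi / ω) = -inp t := by
  rw [(hss.diagram (t + Real.pi / ω)).eq_solve hproper, (hss.diagram t).neg.eq_solve hproper,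
    sin_add_half_period hω, hss.add_half_period hω hproper hβ htwo]

/-- The state on a half period between two resets, started right after the reset. -/
noncomputable def arc (S : ResetLoop) (ω : ℝ) (x : ℝ → S.Idx → ℝ) (inp : ℝ → Block → ℝ) :
    ℝ → S.Idx → ℝ :=
  Function.update x (S.resetTime ω x inp) (S.jump (x (S.resetTime ω x inp)))

theorem arc_of_gt {t : ℝ} (ht : S.resetTime ω x inp < t) : S.arc ω x inp t = x t :=
  Function.update_of_ne ht.ne' _ _

theorem arc_resetTime :
    S.arc ω x inp (S.resetTime ω x inp) = S.jump (x (S.resetTime ω x inp)) :=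
  Function.update_self _ _ _

theorem IsSteadyState.continuousOn_arc (hω : 0 < ω) (hss : S.IsSteadyState ω R x inp)
    (htwo : S.IsTwoReset ω x inp) : ContinuousOn (S.arc ω x inp)
      (Icc (S.resetTime ω x inp) (S.resetTime ω x inp + Real.pi / ω)) := by
  have hmem := htwo.resetTime_mem hω
  exact continuousOn_update_Icc (hss.reset _ hmem)
    (fun t ht => (hss.flow t (htwo.not_mem hω ht)).continuousAt)
    (hss.left_cont _ ((htwo.mem_add_iff hω _).2 hmem))

theorem IsSteadyState.hasDerivAt_arc (hω : 0 < ω)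
    (hproper : (S.sys Block.C1).D * (S.sys Block.C3).D * (S.sys Block.P).D
      * (S.sys Block.C4).D = 0) (hss : S.IsSteadyState ω R x inp)
    (htwo : S.IsTwoReset ω x inp) {t : ℝ}
    (ht : t ∈ Ioo (S.resetTime ω x inp) (S.resetTime ω x inp + Real.pi / ω)) :
    HasDerivAt (S.arc ω x inp) (S.field (S.arc ω x inp t)
      (S.solve (S.arc ω x inp t) (R * Real.sin (ω * t)))) t := by
  rw [arc_of_gt ht.1, ← (hss.diagram t).eq_solve hproper]
  refine (hss.flow t (htwo.not_mem hω ht)).congr_of_eventuallyEq ?_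
  filter_upwards [lt_mem_nhds ht.1] with y hy using arc_of_gt hy

end ResetLoop

/-! ### The base-linear loop gain -/

namespace ResetLoop

variable {S : ResetLoop} {ω R : ℝ} {x : ℝ → S.Idx → ℝ} {inp : ℝ → Block → ℝ}

theorem charMat_mulVec_stateTF (G : LTI) {s : ℂ} (h : (G.charMat s).det ≠ 0) :
    G.charMat s *ᵥ G.stateTF s = fun i => (G.B i : ℂ) := by
  unfold LTI.stateTF
  rw [Matrix.mulVec_mulVec, Matrix.mul_nonsing_inv _ (isUnit_iff_ne_zero.2 h), Matrix.one_mulVec]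

theorem eq_stateTF_smul (G : LTI) {s : ℂ} (h : (G.charMat s).det ≠ 0) {ξ : Fin G.order → ℂ} {c : ℂ}
    (hξ : G.charMat s *ᵥ ξ = fun i => (G.B i : ℂ) * c) : ξ = c • G.stateTF s := by
  rw [Matrix.eq_inv_mulVec_of_mulVec_eq h hξ]
  have : (fun i => (G.B i : ℂ) * c) = c • fun i => (G.B i : ℂ) := by
    ext i
    simp [mul_comm]
  rw [this, Matrix.mulVec_smul]
  rfl

theorem smul_eq_mulVec_add (G : LTI) {s : ℂ} (h : (G.charMat s).det ≠ 0) (c : ℂ)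
    (i : Fin G.order) : s * (c * G.stateTF s i) =
      ((fun j => (G.A i j : ℂ)) ⬝ᵥ fun j => c * G.stateTF s j) + G.B i * c := by
  have h1 := congrFun (charMat_mulVec_stateTF G h) i
  unfold LTI.charMat at h1
  rw [Matrix.sub_mulVec, Matrix.smul_mulVec, Matrix.one_mulVec] at h1
  simp only [Pi.sub_apply, Pi.smul_apply, smul_eq_mul] at h1
  have h2 : ((G.A.map Complex.ofReal) *ᵥ G.stateTF s) i =
      (fun j => (G.A i j : ℂ)) ⬝ᵥ G.stateTF s := rfl
  have h3 : ((fun j => (G.A i j : ℂ)) ⬝ᵥ fun j => c * G.stateTF s j) =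
      c * ((fun j => (G.A i j : ℂ)) ⬝ᵥ G.stateTF s) :=
    dotProduct_smul c _ _
  rw [h2] at h1
  rw [h3]
  linear_combination c * h1

theorem map_ofReal_dotProduct {ι : Type*} [Fintype ι] (L : ℂ →ₗ[ℝ] ℝ) (c : ι → ℝ) (ξ : ι → ℂ) :
    L ((fun i => (c i : ℂ)) ⬝ᵥ ξ) = c ⬝ᵥ fun i => L (ξ i) := by
  unfold dotProduct
  rw [map_sum]
  refine Finset.sum_congr rfl fun i _ => ?_
  rw [← Complex.real_smul, map_smul, smul_eq_mul]

/-- If the base-linear closed loop is Hurwitz, its loop gain avoids `-1` at every frequency `nω` that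
is not a characteristic frequency of a block. -/
theorem one_add_Ll_ne_zero
    (hproper : (S.sys Block.C1).D * (S.sys Block.C3).D * (S.sys Block.P).D
      * (S.sys Block.C4).D = 0) {Acl : Matrix S.Idx S.Idx ℝ} {czs : S.Idx → ℝ}
    (hbl : S.IsBaseLinear Acl czs) (hA : HurwitzMatrix Acl) {n : ℕ}
    (hfreq : ∀ b : Block, ((S.sys b).charMat (jw ω n)).det ≠ 0) : 1 + S.Ll ω n ≠ 0 := by
  intro hL
  set s := jw ω n with hs
  -- These are the phasors of the block inputs in a free oscillation normalised to `z = 1`. The loop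
  -- closes exactly because `L_l = -1`.
  set V : Block → ℂ := fun b => match b with
    | Block.Cr => 1
    | Block.C2 => 1
    | Block.Cs => 1
    | Block.C3 => S.fr ω n Block.Cr + S.fr ω n Block.C2
    | Block.P => S.fr ω n Block.C3 * (S.fr ω n Block.Cr + S.fr ω n Block.C2)
    | Block.C4 => S.fr ω n Block.P * (S.fr ω n Block.C3 * (S.fr ω n Block.Cr + S.fr ω n Block.C2))
    | Block.C1 => -(S.fr ω n Block.C4 * (S.fr ω n Block.P * (S.fr ω n Block.C3 *
        (S.fr ω n Block.Cr + S.fr ω n Block.C2)))) with hV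
  set ξ : S.Idx → ℂ := fun q => V q.1 * (S.sys q.1).stateTF s q.2 with hξ
  have hC1 : S.fr ω n Block.C1 * V Block.C1 = 1 := by
    simp only [hV]
    unfold Ll at hL
    linear_combination -hL
  -- Base-linearity is a statement about real states, so the complex oscillation is tested through
  -- real-linear functionals; the real and imaginary parts suffice.
  have hout : ∀ (L : ℂ →ₗ[ℝ] ℝ) (b : Block),
      S.out (fun q => L (ξ q)) (fun b => L (V b)) b = L (S.fr ω n b * V b) := by
    intro L b
    have h1 : S.fr ω n b * V b = (fun i => ((S.sys b).C i : ℂ)) ⬝ᵥ (fun i => ξ ⟨b, i⟩) +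
        ((S.sys b).D : ℂ) * V b := by
      have : ((fun i => ((S.sys b).C i : ℂ)) ⬝ᵥ fun i => ξ ⟨b, i⟩) =
          V b * ((fun i => ((S.sys b).C i : ℂ)) ⬝ᵥ (S.sys b).stateTF s) :=
        dotProduct_smul (V b) _ _
      rw [this]
      unfold fr LTI.tf
      ring
    rw [h1, map_add, map_ofReal_dotProduct, ← Complex.real_smul, map_smul, smul_eq_mul]
    rfl
  have hdiag : ∀ L : ℂ →ₗ[ℝ] ℝ, S.Diagram (fun q => L (ξ q)) 0 (fun b => L (V b)) := by
    intro L
    constructor <;> simp only [hout]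
    · rw [zero_sub, ← map_neg]
    · rw [hC1]
    · rw [hC1]
    · rw [hC1]
    · rw [← map_add]
      simp only [hV, mul_one]
    · rfl
    · rfl
  have hfield : ∀ (L : ℂ →ₗ[ℝ] ℝ) (q : S.Idx),
      L (s * ξ q) = L (((fun j => (Acl q j : ℂ)) ⬝ᵥ ξ)) := by
    intro L q
    rw [map_ofReal_dotProduct]
    have h1 := congrFun (hbl _ _ (hdiag L)).1 q
    refine Eq.trans ?_ h1
    rw [show s * ξ q = _ from smul_eq_mulVec_add (S.sys q.1) (hfreq q.1) (V q.1) q.2, map_add,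
      map_ofReal_dotProduct, ← Complex.real_smul, map_smul, smul_eq_mul]
    rfl
  have hker : (s • (1 : Matrix S.Idx S.Idx ℂ) - Acl.map Complex.ofReal) *ᵥ ξ = 0 := by
    ext q
    rw [Matrix.sub_mulVec, Matrix.smul_mulVec, Matrix.one_mulVec]
    simp only [Pi.sub_apply, Pi.smul_apply, smul_eq_mul, Pi.zero_apply]
    rw [sub_eq_zero]
    exact Complex.ext (hfield Complex.reLm q) (hfield Complex.imLm q)
  have hs0 : 0 ≤ s.re := by
    rw [hs]
    unfold jw
    rw [Complex.re_mul_ofReal]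
    simp
  have hξ0 : ξ = 0 := by
    rw [Matrix.eq_inv_mulVec_of_mulVec_eq (hA.det_ne_zero hs0) hker, Matrix.mulVec_zero]
  -- With zero state and zero reference the diagram forces `z = 0`, against the normalisation `z =
  -- 1`.
  have h1 := congrFun ((hdiag Complex.reLm).eq_solve hproper) Block.Cr
  rw [hξ0] at h1
  change (1 : ℂ).re = S.solveZ (fun _ => (0 : ℂ).re) 0 at h1
  have h0 : ∀ b, S.stateOut (fun _ => 0) b = 0 := fun b => dotProduct_zero _
  simp [solveZ, h0] at h1

/-! ### Harmonics of the steady state -/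

theorem cexp_half_period (hω : 0 < ω) {n : ℕ} (hn : Odd n) (a : ℝ) :
    Complex.exp (-(jw ω n * (a + Real.pi / ω : ℝ))) = -Complex.exp (-(jw ω n * a)) := by
  have h1 : -(jw ω n * (a + Real.pi / ω : ℝ)) =
      -(jw ω n * a) + -(Complex.I * (n * Real.pi : ℝ)) := by
    have hω' : (ω : ℂ) ≠ 0 := by exact_mod_cast hω.ne'
    unfold jw
    push_cast
    field_simp
    ring
  rw [h1, Complex.exp_add, cexp_neg_I_mul_nat_mul_pi, hn.neg_one_pow]
  ring

theorem phasor_eq_of_odd (hω : 0 < ω) {f g : ℝ → ℝ} {a : ℝ}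
    (hf : ∀ t, f (t + Real.pi / ω) = -f t) (hg : ContinuousOn g (Icc a (a + Real.pi / ω)))
    (hfg : ∀ t, a < t → f t = g t) {n : ℕ} (hn : Odd n) :
    phasor ω n f = 2 * Complex.I * (ω / Real.pi) *
      expIntegral a (a + Real.pi / ω) (jw ω n) g := by
  rw [phasor_of_antiperiodic hω rfl hf hg (fun t ht => hfg t ht.1) n, hn.neg_one_pow]
  unfold jw
  ring

/-- The hypotheses shared by the harmonic analysis below. -/
structure Regular (S : ResetLoop) (ω R : ℝ) (x : ℝ → S.Idx → ℝ) (inp : ℝ → Block → ℝ) : Prop where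
  pos : 0 < ω
  proper : (S.sys Block.C1).D * (S.sys Block.C3).D * (S.sys Block.P).D * (S.sys Block.C4).D = 0
  steady : S.IsSteadyState ω R x inp
  twoReset : S.IsTwoReset ω x inp
  state_add : ∀ t, x (t + Real.pi / ω) = -x t
  inp_add : ∀ t, inp (t + Real.pi / ω) = -inp t
  freq : ∀ b : Block, ∀ n : ℕ, Odd n → ((S.sys b).charMat (jw ω n)).det ≠ 0

/-- Phasor of the input of block `b`. -/
noncomputable def inpPhasor (ω : ℝ) (inp : ℝ → Block → ℝ) (n : ℕ) (b : Block) : ℂ :=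
  phasor ω n (fun t => inp t b)

/-- Phasors of the state of block `b`. -/
noncomputable def statePhasor (S : ResetLoop) (ω : ℝ) (x : ℝ → S.Idx → ℝ) (n : ℕ) (b : Block) :
    Fin (S.sys b).order → ℂ :=
  fun i => phasor ω n (fun t => x t ⟨b, i⟩)

/-- Phasor of the output of block `b`. -/
noncomputable def outPhasor (S : ResetLoop) (ω : ℝ) (x : ℝ → S.Idx → ℝ) (inp : ℝ → Block → ℝ)
    (n : ℕ) (b : Block) : ℂ :=
  (fun i => ((S.sys b).C i : ℂ)) ⬝ᵥ S.statePhasor ω x n b + (S.sys b).D * inpPhasor ω inp n b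

namespace Regular

variable (H : Regular S ω R x inp)
include H

theorem half_period_pos : 0 < Real.pi / ω := div_pos Real.pi_pos H.pos

theorem continuousOn_arc_apply (q : S.Idx) : ContinuousOn (fun t => S.arc ω x inp t q)
    (Icc (S.resetTime ω x inp) (S.resetTime ω x inp + Real.pi / ω)) :=
  continuousOn_pi.1 (H.steady.continuousOn_arc H.pos H.twoReset) q

theorem continuousOn_arc_inp (b : Block) : ContinuousOn
    (fun t => S.solve (S.arc ω x inp t) (R * Real.sin (ω * t)) b)
    (Icc (S.resetTime ω x inp) (S.resetTime ω x inp + Real.pi / ω)) :=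
  continuousOn_solve (H.steady.continuousOn_arc H.pos H.twoReset) (by fun_prop) b

theorem inp_eq {t : ℝ} (ht : S.resetTime ω x inp < t) (b : Block) :
    inp t b = S.solve (S.arc ω x inp t) (R * Real.sin (ω * t)) b := by
  rw [arc_of_gt ht, ← (H.steady.diagram t).eq_solve H.proper]

theorem inpPhasor_eq {n : ℕ} (hn : Odd n) (b : Block) :
    inpPhasor ω inp n b = 2 * Complex.I * (ω / Real.pi) *
      expIntegral (S.resetTime ω x inp) (S.resetTime ω x inp + Real.pi / ω) (jw ω n)
        (fun t => S.solve (S.arc ω x inp t) (R * Real.sin (ω * t)) b) :=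
  phasor_eq_of_odd H.pos (fun t => congrFun (H.inp_add t) b) (H.continuousOn_arc_inp b)
    (fun _ ht => H.inp_eq ht b) hn

theorem statePhasor_eq {n : ℕ} (hn : Odd n) (b : Block) :
    S.statePhasor ω x n b = (2 * Complex.I * (ω / Real.pi)) • fun i =>
      expIntegral (S.resetTime ω x inp) (S.resetTime ω x inp + Real.pi / ω) (jw ω n)
        (fun t => S.arc ω x inp t ⟨b, i⟩) := by
  ext i
  exact phasor_eq_of_odd H.pos (fun t => congrFun (H.state_add t) ⟨b, i⟩)
    (H.continuousOn_arc_apply ⟨b, i⟩) (fun t ht => by rw [arc_of_gt ht]) hn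

theorem inpPhasor_of_even {n : ℕ} (hn : Even n) (b : Block) : inpPhasor ω inp n b = 0 := by
  unfold inpPhasor
  rw [phasor_of_antiperiodic H.pos rfl (fun t => congrFun (H.inp_add t) b)
    (H.continuousOn_arc_inp b) (fun _ ht => H.inp_eq ht.1 b) n, hn.neg_one_pow]
  ring

theorem outPhasor_eq {n : ℕ} (hn : Odd n) (b : Block) :
    phasor ω n (fun t => S.out (x t) (inp t) b) = S.outPhasor ω x inp n b := by
  have hle := (lt_add_of_pos_right (S.resetTime ω x inp) H.half_period_pos).le
  have hX : ContinuousOn (fun t (i : Fin (S.sys b).order) => S.arc ω x inp t ⟨b, i⟩)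
      (Icc (S.resetTime ω x inp) (S.resetTime ω x inp + Real.pi / ω)) :=
    continuousOn_pi.2 fun i => H.continuousOn_arc_apply ⟨b, i⟩
  have hc1 := Matrix.continuousOn_dotProduct_left (S.sys b).C hX
  have hc2 : ContinuousOn
      (fun t => (S.sys b).D * S.solve (S.arc ω x inp t) (R * Real.sin (ω * t)) b)
      (Icc (S.resetTime ω x inp) (S.resetTime ω x inp + Real.pi / ω)) :=
    continuousOn_const.mul (H.continuousOn_arc_inp b)
  have h1 := phasor_eq_of_odd H.pos (f := fun t => S.out (x t) (inp t) b)
    (g := fun t => (S.sys b).C ⬝ᵥ (fun i => S.arc ω x inp t ⟨b, i⟩) +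
      (S.sys b).D * S.solve (S.arc ω x inp t) (R * Real.sin (ω * t)) b)
    (fun t => by
      have : (fun i => (-x t) ⟨b, i⟩) = -fun i => x t ⟨b, i⟩ := rfl
      unfold out
      rw [H.state_add, H.inp_add, this, dotProduct_neg, Pi.neg_apply]
      ring)
    (hc1.add hc2)
    (fun t ht => by
      rw [← H.inp_eq ht, arc_of_gt ht]
      rfl) hn
  rw [h1, expIntegral_add hle hc1 hc2, expIntegral_const_mul, expIntegral_dotProduct hle _ hX]
  unfold outPhasor
  rw [H.inpPhasor_eq hn, H.statePhasor_eq hn, dotProduct_smul, smul_eq_mul]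
  ring

theorem phasor_out_eq_of_forall {n : ℕ} (hn : Odd n) {b b' : Block}
    (h : ∀ t, inp t b = S.out (x t) (inp t) b') :
    inpPhasor ω inp n b = S.outPhasor ω x inp n b' := by
  rw [← H.outPhasor_eq hn]
  unfold inpPhasor
  simp only [h]

theorem phasor_add_of_antiperiodic {f g f' g' : ℝ → ℝ} {a : ℝ}
    (hf : ∀ t, f (t + Real.pi / ω) = -f t) (hg : ∀ t, g (t + Real.pi / ω) = -g t)
    (hf' : ContinuousOn f' (Icc a (a + Real.pi / ω)))
    (hg' : ContinuousOn g' (Icc a (a + Real.pi / ω)))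
    (hff' : ∀ t, a < t → f t = f' t) (hgg' : ∀ t, a < t → g t = g' t) {n : ℕ} (hn : Odd n) :
    phasor ω n (fun t => f t + g t) = phasor ω n f + phasor ω n g := by
  have hle := (lt_add_of_pos_right a H.half_period_pos).le
  rw [phasor_eq_of_odd H.pos hf hf' hff' hn, phasor_eq_of_odd H.pos hg hg' hgg' hn,
    phasor_eq_of_odd H.pos (f := fun t => f t + g t) (g := fun t => f' t + g' t)
      (fun t => by rw [hf, hg]; ring) (hf'.add hg')
      (fun t ht => by rw [hff' t ht, hgg' t ht]) hn, expIntegral_add hle hf' hg']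
  ring

theorem out_add_half_period (b : Block) (t : ℝ) :
    S.out (x (t + Real.pi / ω)) (inp (t + Real.pi / ω)) b = -S.out (x t) (inp t) b := by
  have : (fun i => (-x t) ⟨b, i⟩) = -fun i => x t ⟨b, i⟩ := rfl
  unfold out
  rw [H.state_add, H.inp_add, this, dotProduct_neg, Pi.neg_apply]
  ring

theorem continuousOn_arc_out (b : Block) : ContinuousOn
    (fun t => S.out (S.arc ω x inp t) (S.solve (S.arc ω x inp t) (R * Real.sin (ω * t))) b)
    (Icc (S.resetTime ω x inp) (S.resetTime ω x inp + Real.pi / ω)) :=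
  (continuousOn_stateOut (H.steady.continuousOn_arc H.pos H.twoReset) b).add
    (continuousOn_const.mul (H.continuousOn_arc_inp b))

theorem out_eq_arc {t : ℝ} (ht : S.resetTime ω x inp < t) (b : Block) :
    S.out (x t) (inp t) b =
      S.out (S.arc ω x inp t) (S.solve (S.arc ω x inp t) (R * Real.sin (ω * t))) b := by
  rw [arc_of_gt ht, ← (H.steady.diagram t).eq_solve H.proper]

theorem inpPhasor_C3 {n : ℕ} (hn : Odd n) : inpPhasor ω inp n Block.C3 =
    S.outPhasor ω x inp n Block.Cr + S.outPhasor ω x inp n Block.C2 := by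
  rw [← H.outPhasor_eq hn, ← H.outPhasor_eq hn, ← H.phasor_add_of_antiperiodic
    (H.out_add_half_period _) (H.out_add_half_period _) (H.continuousOn_arc_out _)
    (H.continuousOn_arc_out _) (fun _ ht => H.out_eq_arc ht _) (fun _ ht => H.out_eq_arc ht _) hn]
  unfold inpPhasor
  simp only [fun t => (H.steady.diagram t).v_eq]

theorem inpPhasor_C1 {n : ℕ} (hn : Odd n) : inpPhasor ω inp n Block.C1 +
    S.outPhasor ω x inp n Block.C4 = if n = 1 then (R : ℂ) else 0 := by
  rw [← H.outPhasor_eq hn]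
  unfold inpPhasor
  rw [← H.phasor_add_of_antiperiodic (fun t => congrFun (H.inp_add t) Block.C1)
    (H.out_add_half_period _) (H.continuousOn_arc_inp _)
    (H.continuousOn_arc_out _) (fun _ ht => H.inp_eq ht _) (fun _ ht => H.out_eq_arc ht _) hn,
    ← phasor_sin H.pos R le_rfl]
  congr 1
  ext t
  rw [(H.steady.diagram t).e_eq]
  simp

/-- The block equation for the harmonics of the state, with the contribution of the resets. -/
theorem charMat_mulVec_statePhasor {n : ℕ} (hn : Odd n) (b : Block) :
    (S.sys b).charMat (jw ω n) *ᵥ S.statePhasor ω x n b = fun i =>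
      (S.sys b).B i * inpPhasor ω inp n b + 2 * Complex.I * (ω / Real.pi) *
        Complex.exp (-(jw ω n * (S.resetTime ω x inp : ℝ))) *
        (S.jump (x (S.resetTime ω x inp)) ⟨b, i⟩ - x (S.resetTime ω x inp) ⟨b, i⟩ : ℝ) := by
  have hlt := lt_add_of_pos_right (S.resetTime ω x inp) H.half_period_pos
  have hX : ContinuousOn (fun t (i : Fin (S.sys b).order) => S.arc ω x inp t ⟨b, i⟩)
      (Icc (S.resetTime ω x inp) (S.resetTime ω x inp + Real.pi / ω)) :=
    continuousOn_pi.2 fun i => H.continuousOn_arc_apply ⟨b, i⟩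
  have h1 := mulVec_expIntegral_of_hasDerivAt (s := jw ω n) (A := (S.sys b).A) (B := (S.sys b).B)
    (u := fun t => S.solve (S.arc ω x inp t) (R * Real.sin (ω * t)) b) hlt.le hX
    (H.continuousOn_arc_inp b) (fun t ht => hasDerivAt_pi.2 fun i =>
      hasDerivAt_pi.1 (H.steady.hasDerivAt_arc H.pos H.proper H.twoReset ht) ⟨b, i⟩)
  unfold LTI.charMat
  rw [H.statePhasor_eq hn, H.inpPhasor_eq hn, Matrix.mulVec_smul, h1]
  ext i
  -- At the far end both the state and, for odd `n`, the exponential change sign. The two boundary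
  -- terms therefore combine into the jump at the reset instant.
  rw [cexp_half_period H.pos hn, arc_resetTime, arc_of_gt hlt, H.state_add]
  simp only [Pi.smul_apply, smul_eq_mul, Pi.neg_apply]
  push_cast
  ring

theorem outPhasor_of_ne {n : ℕ} (hn : Odd n) {b : Block} (hb : b ≠ Block.Cr) :
    S.outPhasor ω x inp n b = S.fr ω n b * inpPhasor ω inp n b := by
  have h1 : S.statePhasor ω x n b = inpPhasor ω inp n b • (S.sys b).stateTF (jw ω n) := by
    refine eq_stateTF_smul _ (H.freq b n hn) ?_
    rw [H.charMat_mulVec_statePhasor hn b]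
    ext i
    have : S.eRho ⟨b, i⟩ = 0 := by
      unfold eRho
      rw [Pi.single_eq_of_ne]
      exact fun h => hb (congrArg Sigma.fst h)
    rw [jump_eq]
    simp [this]
  unfold outPhasor
  rw [h1, dotProduct_smul, smul_eq_mul]
  unfold fr LTI.tf
  ring

end Regular

end ResetLoop

namespace ResetLoop

variable {S : ResetLoop} {ω R : ℝ} {x : ℝ → S.Idx → ℝ} {inp : ℝ → Block → ℝ}

/-! ### The reset amplitude -/

theorem Arho_sub_one_mulVec (v : Fin (S.sys Block.Cr).order → ℝ) :
    (S.Arho - 1) *ᵥ v = ((S.γ - 1) * v S.rho) • Pi.single S.rho 1 := by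
  rw [Matrix.sub_mulVec, Arho_mulVec, Matrix.one_mulVec, add_sub_cancel_left]

/-- The jump of the reset controller is proportional to `Δ_q`, with the factor determined by the
base-linear part `xb` of the state. -/
theorem Arho_sub_one_mulVec_eq_DeltaQ (hq : (S.Arho * S.expAR ω + 1).det ≠ 0)
    (hΔ : S.DeltaC1 ω ≠ 0) {xr xb v : Fin (S.sys Block.Cr).order → ℝ}
    (hv : (1 + S.expAR ω) *ᵥ v = (S.Arho - 1) *ᵥ xr) (hxb : xb = xr + S.expAR ω *ᵥ v) :
    (S.Arho - 1) *ᵥ xr = (xb S.rho / S.DeltaC1 ω) • S.DeltaQ ω := by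
  have h1 : (S.Arho * S.expAR ω + 1) *ᵥ v = (S.Arho - 1) *ᵥ xb := by
    rw [hxb, Matrix.mulVec_add, ← hv, Matrix.mulVec_mulVec, ← Matrix.add_mulVec]
    congr 1
    noncomm_ring
  -- `A_ρ - I` sees only the reset component, so `xb` may be replaced by a multiple of `Δ_c`.
  have h2 : (S.Arho - 1) *ᵥ xb = (xb S.rho / S.DeltaC1 ω) • ((S.Arho - 1) *ᵥ S.DeltaC ω) := by
    rw [Arho_sub_one_mulVec, Arho_sub_one_mulVec, smul_smul]
    congr 1
    change _ = xb S.rho / S.DeltaC1 ω * ((S.γ - 1) * S.DeltaC1 ω)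
    field_simp
  have h3 : v = (S.Arho * S.expAR ω + 1)⁻¹ *ᵥ
      ((xb S.rho / S.DeltaC1 ω) • ((S.Arho - 1) *ᵥ S.DeltaC ω)) := by
    rw [← h2, ← h1, Matrix.mulVec_mulVec, Matrix.nonsing_inv_mul _ (isUnit_iff_ne_zero.2 hq),
      Matrix.one_mulVec]
  rw [← hv, h3, Matrix.mulVec_smul, Matrix.mulVec_smul]
  unfold DeltaQ
  rw [Matrix.mulVec_mulVec, Matrix.mulVec_mulVec, mul_assoc]

theorem charMat_det_conj (G : LTI) (s : ℂ) :
    (G.charMat ((starRingEnd ℂ) s)).det = (starRingEnd ℂ) (G.charMat s).det := by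
  rw [RingHom.map_det]
  congr 1
  ext i j
  simp [LTI.charMat, Matrix.one_apply, apply_ite (starRingEnd ℂ)]

namespace Regular

variable (H : Regular S ω R x inp)
include H

/-- Negative odd frequencies reduce to positive ones by conjugation, since the system matrices are
real. -/
theorem charMat_det_int_ne_zero (b : Block) (k : ℤ) :
    ((S.sys b).charMat (Complex.I * (ω + 2 * ω * k : ℝ))).det ≠ 0 := by
  obtain ⟨n, rfl | rfl⟩ := k.eq_nat_or_neg
  · have h1 := H.freq b (2 * n + 1) ⟨n, rfl⟩
    unfold jw at h1
    have h2 : (ω + 2 * ω * ((n : ℕ) : ℤ) : ℝ) = ((2 * n + 1 : ℕ) : ℝ) * ω := by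
      push_cast
      ring
    rwa [h2]
  · cases n with
    | zero =>
      have h1 := H.freq b 1 odd_one
      unfold jw at h1
      simpa using h1
    | succ n =>
      have h1 := H.freq b (2 * n + 1) ⟨n, rfl⟩
      have h2 : Complex.I * (ω + 2 * ω * (-((n + 1 : ℕ) : ℤ) : ℤ) : ℝ) =
          (starRingEnd ℂ) (jw ω (2 * n + 1)) := by
        unfold jw
        rw [map_mul, Complex.conj_I, Complex.conj_ofReal]
        push_cast
        ring
      rw [h2, charMat_det_conj]
      exact (map_ne_zero _).2 h1

/-- The jump of the state of the reset controller is a multiple of `Δ_q`; the factor is the Fourier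
series of the base-linear part of the reset state at the reset instant. -/
theorem exists_resetAmplitude (hq : (S.Arho * S.expAR ω + 1).det ≠ 0) (hΔ : S.DeltaC1 ω ≠ 0) :
    ∃ κ : ℝ, (∀ i, S.jump (x (S.resetTime ω x inp)) ⟨Block.Cr, i⟩ -
        x (S.resetTime ω x inp) ⟨Block.Cr, i⟩ = κ * S.DeltaQ ω i) ∧
      HasSum (fun k : ℕ => (S.DeltaL ω (2 * k + 1) S.rho * inpPhasor ω inp (2 * k + 1) Block.Cr *
        Complex.exp (jw ω (2 * k + 1) * (S.resetTime ω x inp : ℝ))).im) (κ * S.DeltaC1 ω) := by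
  set a := S.resetTime ω x inp with ha
  have hpos := H.half_period_pos
  have hlt : a < a + Real.pi / ω := lt_add_of_pos_right _ hpos
  set xr : Fin (S.sys Block.Cr).order → ℝ := fun i => x a ⟨Block.Cr, i⟩ with hxr
  have hdet : (1 + S.expAR ω).det ≠ 0 :=
    Matrix.det_one_add_exp_ne_zero _ H.pos (H.charMat_det_int_ne_zero Block.Cr)
  -- This is the initial value for which the free motion `y`, continued with alternating sign, has
  -- exactly the jump of the controller state: `y(a) + y(a + π/ω) = (A_ρ - I) xr`.
  set v := (1 + S.expAR ω)⁻¹ *ᵥ ((S.Arho - 1) *ᵥ xr) with hv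
  have hv1 : (1 + S.expAR ω) *ᵥ v = (S.Arho - 1) *ᵥ xr := by
    rw [hv, Matrix.mulVec_mulVec, Matrix.mul_nonsing_inv _ (isUnit_iff_ne_zero.2 hdet),
      Matrix.one_mulVec]
  have hjump : ∀ i, S.jump (x a) ⟨Block.Cr, i⟩ - x a ⟨Block.Cr, i⟩ = ((S.Arho - 1) *ᵥ xr) i := by
    intro i
    rw [Matrix.sub_mulVec, Matrix.one_mulVec]
    rfl
  set y : ℝ → Fin (S.sys Block.Cr).order → ℝ := fun t =>
    NormedSpace.exp ((t - a) • (S.sys Block.Cr).A) *ᵥ v with hy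
  have hyd : ∀ t, HasDerivAt y ((S.sys Block.Cr).A *ᵥ y t) t := fun t =>
    Matrix.hasDerivAt_exp_smul_mulVec _ v a t
  have hya : y a = v := by
    simp only [hy]
    rw [sub_self, zero_smul, NormedSpace.exp_zero, Matrix.one_mulVec]
  have hyb : y (a + Real.pi / ω) = S.expAR ω *ᵥ v := by
    simp only [hy]
    rw [add_sub_cancel_left]
    rfl
  -- Subtracting `y` removes the jump. What remains is the antiperiodic response of the controller
  -- to `z` without resets, whose Fourier series converges to its value at the reset instant.
  set Xb : ℝ → Fin (S.sys Block.Cr).order → ℝ := fun t i =>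
    S.arc ω x inp t ⟨Block.Cr, i⟩ - y t i with hXb
  set u : ℝ → ℝ := fun t => S.solve (S.arc ω x inp t) (R * Real.sin (ω * t)) Block.Cr with hu
  have hXbc : ContinuousOn Xb (Icc a (a + Real.pi / ω)) := by
    refine continuousOn_pi.2 fun i => (H.continuousOn_arc_apply ⟨Block.Cr, i⟩).sub ?_
    exact fun t _ => ((hasDerivAt_pi.1 (hyd t) i).continuousAt).continuousWithinAt
  have huc : ContinuousOn u (Icc a (a + Real.pi / ω)) := H.continuousOn_arc_inp Block.Cr
  have hXbd : ∀ t ∈ Ioo a (a + Real.pi / ω), HasDerivAt Xb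
      (fun i => ((S.sys Block.Cr).A *ᵥ Xb t) i + (S.sys Block.Cr).B i * u t) t := by
    intro t ht
    refine hasDerivAt_pi.2 fun i => ?_
    have h1 := (hasDerivAt_pi.1 (H.steady.hasDerivAt_arc H.pos H.proper H.twoReset ht)
      ⟨Block.Cr, i⟩).sub (hasDerivAt_pi.1 (hyd t) i)
    have h2 : Xb t = (fun i => S.arc ω x inp t ⟨Block.Cr, i⟩) - y t := rfl
    rw [h2, Matrix.mulVec_sub]
    refine h1.congr_deriv ?_
    simp only [field, Pi.sub_apply, hu]
    ring
  have hXba : Xb a = xr + S.expAR ω *ᵥ v := by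
    have h1 : Xb a = xr + (S.Arho - 1) *ᵥ xr - v := by
      ext i
      simp only [hXb, hya, Pi.sub_apply, Pi.add_apply]
      rw [← hjump, ha, arc_resetTime]
      simp only [hxr, ha]
      ring
    rw [h1, ← hv1, Matrix.add_mulVec, Matrix.one_mulVec]
    abel
  have hXbb : Xb (a + Real.pi / ω) = -Xb a := by
    rw [hXba]
    ext i
    simp only [hXb, hyb, Pi.neg_apply, Pi.add_apply]
    rw [arc_of_gt hlt, H.state_add]
    simp only [hxr, Pi.neg_apply]
    ring
  have hanti : ∀ i, (Xb a i : ℂ) * Complex.exp (-(Complex.I * ω * a)) =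
      Xb (a + Real.pi / ω) i * Complex.exp (-(Complex.I * ω * (a + Real.pi / ω : ℝ))) := by
    intro i
    have h1 := cexp_half_period H.pos odd_one a
    have h2 : jw ω 1 = Complex.I * ω := by simp [jw]
    rw [h2] at h1
    rw [h1, hXbb]
    simp
  refine ⟨Xb a S.rho / S.DeltaC1 ω, fun i => ?_, ?_⟩
  · rw [hjump, Arho_sub_one_mulVec_eq_DeltaQ hq hΔ hv1 hXba]
    rfl
  · rw [div_mul_cancel₀ _ hΔ]
    have hsum := hasSum_expIntegral hlt (continuousOn_pi.1 hXbc S.rho)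
      (fun t ht => hasDerivAt_pi.1 (hXbd t ht) S.rho)
      ((continuousOn_pi.1 (Matrix.continuousOn_mulVec_left _ hXbc) S.rho).add
        (continuousOn_const.mul huc)) (hanti S.rho) (left_mem_Icc.2 hlt.le)
    have hfreq : ∀ k : ℤ, ω + 2 * Real.pi * k / (a + Real.pi / ω - a) = ω + 2 * ω * k := by
      intro k
      have := Real.pi_pos
      have := H.pos
      rw [add_sub_cancel_left]
      field_simp
    simp only [hfreq] at hsum
    -- The indices `k` and `-(k+1)` give the opposite frequencies `±(2k+1)ω`; their terms are
    -- conjugate and add up to a real one.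
    have hpair := hsum.nat_add_neg_add_one
    have hterm : ∀ k : ℕ, expIntegral a (a + Real.pi / ω)
          (Complex.I * (ω + 2 * ω * ((k : ℤ) : ℝ) : ℝ)) (fun t => Xb t S.rho) *
          Complex.exp (Complex.I * (ω + 2 * ω * ((k : ℤ) : ℝ) : ℝ) * a) +
        expIntegral a (a + Real.pi / ω)
          (Complex.I * (ω + 2 * ω * ((-((k : ℤ) + 1) : ℤ) : ℝ) : ℝ)) (fun t => Xb t S.rho) *
          Complex.exp (Complex.I * (ω + 2 * ω * ((-((k : ℤ) + 1) : ℤ) : ℝ) : ℝ) * a) =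
        ((Real.pi / ω * (S.DeltaL ω (2 * k + 1) S.rho * inpPhasor ω inp (2 * k + 1) Block.Cr *
          Complex.exp (jw ω (2 * k + 1) * a)).im : ℝ) : ℂ) := by
      intro k
      have hodd : Odd (2 * k + 1) := ⟨k, rfl⟩
      have e1 : Complex.I * (ω + 2 * ω * ((k : ℤ) : ℝ) : ℝ) = jw ω (2 * k + 1) := by
        unfold jw
        push_cast
        ring
      have e2 : Complex.I * (ω + 2 * ω * ((-((k : ℤ) + 1) : ℤ) : ℝ) : ℝ) =
          -(Complex.I * (ω + 2 * ω * ((k : ℤ) : ℝ) : ℝ)) := by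
        push_cast
        ring
      rw [e2, expIntegral_conj]
      have e3 : Complex.exp (-(Complex.I * (ω + 2 * ω * ((k : ℤ) : ℝ) : ℝ)) * a) =
          (starRingEnd ℂ) (Complex.exp (Complex.I * (ω + 2 * ω * ((k : ℤ) : ℝ) : ℝ) * a)) := by
        rw [← Complex.exp_conj, map_mul, map_mul, Complex.conj_I, Complex.conj_ofReal,
          Complex.conj_ofReal]
        ring_nf
      rw [e3, ← map_mul, Complex.add_conj, e1]
      have h1 := mulVec_expIntegral_of_hasDerivAt (s := jw ω (2 * k + 1)) hlt.le hXbc huc hXbd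
      have h2 : (fun i => ((S.sys Block.Cr).B i : ℂ) *
          expIntegral a (a + Real.pi / ω) (jw ω (2 * k + 1)) u +
          Xb a i * Complex.exp (-(jw ω (2 * k + 1) * a)) -
          Xb (a + Real.pi / ω) i * Complex.exp (-(jw ω (2 * k + 1) * (a + Real.pi / ω : ℝ)))) =
          fun i => ((S.sys Block.Cr).B i : ℂ) *
            expIntegral a (a + Real.pi / ω) (jw ω (2 * k + 1)) u := by
        ext i
        rw [cexp_half_period H.pos hodd, hXbb]
        push_cast [Pi.neg_apply]
        ring
      rw [h2] at h1
      have h3 := congrFun (eq_stateTF_smul (S.sys Block.Cr) (H.freq Block.Cr _ hodd) h1) S.rho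
      rw [h3, H.inpPhasor_eq hodd]
      simp only [Pi.smul_apply, smul_eq_mul]
      set q : ℂ := expIntegral a (a + Real.pi / ω) (jw ω (2 * k + 1)) u *
        (S.sys Block.Cr).stateTF (jw ω (2 * k + 1)) S.rho *
        Complex.exp (jw ω (2 * k + 1) * a) with hqdef
      have h4 : S.DeltaL ω (2 * k + 1) S.rho * (2 * Complex.I * (ω / Real.pi) *
          expIntegral a (a + Real.pi / ω) (jw ω (2 * k + 1)) u) *
          Complex.exp (jw ω (2 * k + 1) * a) = Complex.I * ((2 * (ω / Real.pi) : ℝ) * q) := by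
        rw [hqdef]
        unfold DeltaL
        push_cast
        ring
      rw [h4, Complex.I_mul_im, Complex.re_ofReal_mul]
      have := Real.pi_pos.ne'
      have := H.pos.ne'
      congr 1
      field_simp
    simp only [hterm] at hpair
    have hre := ((Complex.hasSum_iff _ _).1 hpair).1
    simp only [Complex.ofReal_re] at hre
    have hval : (((a + Real.pi / ω : ℝ) - (a : ℝ) : ℂ) * (Xb a S.rho : ℝ)).re =
        Real.pi / ω * Xb a S.rho := by
      rw [← Complex.ofReal_sub, add_sub_cancel_left, ← Complex.ofReal_mul, Complex.ofReal_re]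
    rw [hval] at hre
    have hfin := hre.mul_left (Real.pi / ω)⁻¹
    simp only [inv_mul_cancel_left₀ hpos.ne'] at hfin
    exact hfin

end Regular

end ResetLoop

/-! ### Moduli, arguments and imaginary parts -/

theorem norm_mul_sin_arg_sub (z : ℂ) (θ : ℝ) :
    ‖z‖ * Real.sin (z.arg - θ) = (z * Complex.exp (-(Complex.I * θ))).im := by
  have h1 : z * Complex.exp (-(Complex.I * θ)) =
      (‖z‖ : ℂ) * Complex.exp ((z.arg - θ : ℝ) * Complex.I) := by
    conv_lhs => rw [← Complex.norm_mul_exp_arg_mul_I z]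
    rw [mul_assoc, ← Complex.exp_add]
    push_cast
    ring_nf
  rw [h1, Complex.im_ofReal_mul, Complex.exp_ofReal_mul_I_im]

/-- Polar form turns the trigonometric expression in `Ψ_n Δ_cⁿ` into an imaginary part. If `z`, `l`
or `w` is zero, both sides vanish, so no case distinction is needed. -/
theorem norm_div_mul_sin_arg (z l w : ℂ) (θ : ℝ) :
    ‖l‖ / ‖w‖ * (‖z‖ * Real.sin (z.arg + l.arg - w.arg - θ)) =
      (z * l / w * Complex.exp (-(Complex.I * θ))).im := by
  have h1 : z * l / w * Complex.exp (-(Complex.I * θ)) =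
      ((‖l‖ / ‖w‖ * ‖z‖ : ℝ) : ℂ) *
        Complex.exp ((z.arg + l.arg - w.arg - θ : ℝ) * Complex.I) := by
    conv_lhs => rw [← Complex.norm_mul_exp_arg_mul_I z, ← Complex.norm_mul_exp_arg_mul_I l,
      ← Complex.norm_mul_exp_arg_mul_I w]
    have h2 : Complex.exp ((z.arg + l.arg - w.arg - θ : ℝ) * Complex.I) =
        Complex.exp (z.arg * Complex.I) * Complex.exp (l.arg * Complex.I) /
          Complex.exp (w.arg * Complex.I) * Complex.exp (-(Complex.I * θ)) := by
      rw [← Complex.exp_add, ← Complex.exp_sub, ← Complex.exp_add]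
      push_cast
      ring_nf
    rw [h2]
    push_cast
    ring
  rw [h1, Complex.im_ofReal_mul, Complex.exp_ofReal_mul_I_im]
  ring

/-- Arguments add only modulo `2π`, but their exponentials multiply exactly; phases are therefore
compared through exponentials. -/
theorem cexp_I_arg_mul {z w : ℂ} (hz : z ≠ 0) (hw : w ≠ 0) :
    Complex.exp (Complex.I * (z * w).arg) =
      Complex.exp (Complex.I * z.arg) * Complex.exp (Complex.I * w.arg) := by
  have hz' : (‖z‖ : ℂ) ≠ 0 := by simpa using hz
  have hw' : (‖w‖ : ℂ) ≠ 0 := by simpa using hw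
  have h1 := Complex.norm_mul_exp_arg_mul_I (z * w)
  have h2 := Complex.norm_mul_exp_arg_mul_I z
  have h3 := Complex.norm_mul_exp_arg_mul_I w
  rw [mul_comm (_ : ℂ) Complex.I] at h1 h2 h3
  apply mul_left_cancel₀ (mul_ne_zero hz' hw')
  rw [norm_mul] at h1
  push_cast at h1
  rw [h1]
  conv_lhs => rw [← h2, ← h3]
  ring

theorem cexp_nat_mul_I (n : ℕ) (θ : ℝ) :
    Complex.exp (Complex.I * (n * θ : ℝ)) = Complex.exp (Complex.I * θ) ^ n := by
  rw [← Complex.exp_nat_mul]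
  push_cast
  ring_nf

namespace ResetLoop

variable {S : ResetLoop} {ω R : ℝ} {x : ℝ → S.Idx → ℝ} {inp : ℝ → Block → ℝ}

theorem Psi_mul_DeltaCn (n : ℕ) : S.Psi ω n * S.DeltaCn ω n =
    -(S.DeltaL ω n S.rho * S.Lrho ω n / (1 + S.Ll ω n) *
      Complex.exp (-(Complex.I * (n * (S.fr ω 1 Block.Cs).arg : ℝ)))).im := by
  rw [← norm_div_mul_sin_arg]
  unfold Psi DeltaCn
  ring

namespace Regular

variable (H : Regular S ω R x inp)
include H

/-! ### The harmonics of the loop -/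

theorem trigger_phasor : phasor ω 1 (S.trigger x inp) =
    S.fr ω 1 Block.Cs * inpPhasor ω inp 1 Block.Cr := by
  have h1 : inpPhasor ω inp 1 Block.Cs = inpPhasor ω inp 1 Block.Cr := by
    unfold inpPhasor
    simp only [fun t => (H.steady.diagram t).zr_eq, fun t => (H.steady.diagram t).zs_eq]
  rw [← h1, ← H.outPhasor_of_ne odd_one (by decide), ← H.outPhasor_eq odd_one]
  rfl

theorem inpPhasor_Cr_ne_zero : inpPhasor ω inp 1 Block.Cr ≠ 0 := by
  have h1 := H.twoReset.first_ne_zero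
  rw [H.trigger_phasor] at h1
  exact right_ne_zero_of_mul h1

/-- The direction of the first harmonic of `z`. -/
theorem cexp_resetTime (n : ℕ) : Complex.exp (-(jw ω n * (S.resetTime ω x inp : ℝ))) =
    Complex.exp (Complex.I * (n * (S.fr ω 1 Block.Cs).arg : ℝ)) *
      Complex.exp (Complex.I * (inpPhasor ω inp 1 Block.Cr).arg) ^ n := by
  have h1 := H.twoReset.first_ne_zero
  have h2 : -(jw ω n * (S.resetTime ω x inp : ℝ)) =
      Complex.I * (n * S.trigPhase ω x inp : ℝ) := by
    have : (ω : ℂ) ≠ 0 := by exact_mod_cast H.pos.ne'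
    unfold jw resetTime
    push_cast
    field_simp
  rw [H.trigger_phasor] at h1
  rw [h2, cexp_nat_mul_I, cexp_nat_mul_I, trigPhase, H.trigger_phasor,
    cexp_I_arg_mul (left_ne_zero_of_mul h1) (right_ne_zero_of_mul h1), mul_pow]

/-- The jump `κ Δ_q` acts as an extra input to the resolvent. The factor `jnω` of `Δ_x` against
`1/(nπ)` in `C_ρⁿ` reproduces the normalisation `2jω/π` of the phasor, and the phase of the reset
instant splits into those of `C_s` and `Z¹`. -/
theorem outPhasor_Cr {n : ℕ} (hn : Odd n) {κ : ℝ}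
    (hκ : ∀ i, S.jump (x (S.resetTime ω x inp)) ⟨Block.Cr, i⟩ -
        x (S.resetTime ω x inp) ⟨Block.Cr, i⟩ = κ * S.DeltaQ ω i) :
    S.outPhasor ω x inp n Block.Cr = S.fr ω n Block.Cr * inpPhasor ω inp n Block.Cr +
      κ * S.Crho ω n * Complex.exp (Complex.I * (inpPhasor ω inp 1 Block.Cr).arg) ^ n := by
  have hdet := H.freq Block.Cr n hn
  set c : ℂ := 2 * Complex.I * (ω / Real.pi) *
    Complex.exp (-(jw ω n * (S.resetTime ω x inp : ℝ))) * κ with hc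
  have h1 : (S.sys Block.Cr).charMat (jw ω n) *ᵥ S.statePhasor ω x n Block.Cr =
      inpPhasor ω inp n Block.Cr • (fun i => ((S.sys Block.Cr).B i : ℂ)) +
        c • fun i => (S.DeltaQ ω i : ℂ) := by
    rw [H.charMat_mulVec_statePhasor hn]
    ext i
    rw [hκ]
    simp only [Pi.add_apply, Pi.smul_apply, smul_eq_mul, hc]
    push_cast
    ring
  have h2 := Matrix.eq_inv_mulVec_of_mulVec_eq hdet h1
  rw [Matrix.mulVec_add, Matrix.mulVec_smul, Matrix.mulVec_smul] at h2
  unfold outPhasor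
  rw [h2, dotProduct_add, dotProduct_smul, dotProduct_smul, smul_eq_mul, smul_eq_mul, hc,
    H.cexp_resetTime n]
  unfold Crho DeltaX
  generalize Complex.exp (Complex.I * (n * (S.fr ω 1 Block.Cs).arg : ℝ)) = θ
  unfold fr LTI.tf LTI.stateTF
  rw [smul_dotProduct, ← Matrix.dotProduct_mulVec, smul_eq_mul]
  have hn0 : (n : ℂ) ≠ 0 := by
    have := hn.pos.ne'
    exact_mod_cast this
  have hπ : (Real.pi : ℂ) ≠ 0 := by exact_mod_cast Real.pi_pos.ne'
  unfold jw
  push_cast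
  field_simp
  ring

/-- The linear equations satisfied by the `n`-th harmonics. -/
theorem loop_equations {n : ℕ} (hn : Odd n) {κ : ℝ}
    (hκ : ∀ i, S.jump (x (S.resetTime ω x inp)) ⟨Block.Cr, i⟩ -
        x (S.resetTime ω x inp) ⟨Block.Cr, i⟩ = κ * S.DeltaQ ω i) :
    inpPhasor ω inp n Block.Cr = S.fr ω n Block.C1 * inpPhasor ω inp n Block.C1 ∧
    inpPhasor ω inp n Block.P = S.fr ω n Block.C3 *
      ((S.fr ω n Block.Cr + S.fr ω n Block.C2) * inpPhasor ω inp n Block.Cr +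
        κ * S.Crho ω n * Complex.exp (Complex.I * (inpPhasor ω inp 1 Block.Cr).arg) ^ n) ∧
    inpPhasor ω inp n Block.C4 = S.fr ω n Block.P * inpPhasor ω inp n Block.P ∧
    inpPhasor ω inp n Block.C1 + S.fr ω n Block.C4 * inpPhasor ω inp n Block.C4 =
      if n = 1 then (R : ℂ) else 0 := by
  have hz2 : inpPhasor ω inp n Block.C2 = inpPhasor ω inp n Block.Cr := by
    unfold inpPhasor
    simp only [fun t => (H.steady.diagram t).zr_eq, fun t => (H.steady.diagram t).z2_eq]
  refine ⟨?_, ?_, ?_, ?_⟩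
  · rw [← H.outPhasor_of_ne hn (by decide)]
    exact H.phasor_out_eq_of_forall hn fun t => (H.steady.diagram t).zr_eq
  · rw [H.phasor_out_eq_of_forall hn (fun t => (H.steady.diagram t).u_eq),
      H.outPhasor_of_ne hn (by decide), H.inpPhasor_C3 hn, H.outPhasor_Cr hn hκ,
      H.outPhasor_of_ne hn (by decide), hz2]
    ring
  · rw [← H.outPhasor_of_ne hn (by decide)]
    exact H.phasor_out_eq_of_forall hn fun t => (H.steady.diagram t).y_eq
  · rw [← H.outPhasor_of_ne hn (by decide)]
    exact H.inpPhasor_C1 hn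

theorem inpPhasor_Cr_mul {n : ℕ} (hn : Odd n) (hn1 : n ≠ 1) {κ : ℝ}
    (hκ : ∀ i, S.jump (x (S.resetTime ω x inp)) ⟨Block.Cr, i⟩ -
        x (S.resetTime ω x inp) ⟨Block.Cr, i⟩ = κ * S.DeltaQ ω i) :
    inpPhasor ω inp n Block.Cr * (1 + S.Ll ω n) = -(κ * S.Lrho ω n *
      Complex.exp (Complex.I * (inpPhasor ω inp 1 Block.Cr).arg) ^ n) := by
  obtain ⟨h1, h2, h3, h4⟩ := H.loop_equations hn hκ
  rw [if_neg hn1] at h4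
  unfold Ll Lrho
  linear_combination h1 + S.fr ω n Block.C1 * h4 -
    S.fr ω n Block.C1 * S.fr ω n Block.C4 * h3 -
    S.fr ω n Block.C1 * S.fr ω n Block.C4 * S.fr ω n Block.P * h2

/-- The reset amplitude is `Γ` times the amplitude of the first harmonic of `z`. -/
theorem resetAmplitude_eq (hΔ : S.DeltaC1 ω ≠ 0) (hL : ∀ n, Odd n → 1 + S.Ll ω n ≠ 0) {κ : ℝ}
    (hκ : ∀ i, S.jump (x (S.resetTime ω x inp)) ⟨Block.Cr, i⟩ -
        x (S.resetTime ω x inp) ⟨Block.Cr, i⟩ = κ * S.DeltaQ ω i)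
    (hsum : HasSum (fun k : ℕ => (S.DeltaL ω (2 * k + 1) S.rho *
      inpPhasor ω inp (2 * k + 1) Block.Cr *
        Complex.exp (jw ω (2 * k + 1) * (S.resetTime ω x inp : ℝ))).im) (κ * S.DeltaC1 ω)) :
    Summable (fun k : ℕ => S.Psi ω (2 * k + 3) * S.DeltaCn ω (2 * k + 3)) ∧
      1 - S.PsiSum ω / S.DeltaC1 ω ≠ 0 ∧
      κ = S.Gam ω * ‖inpPhasor ω inp 1 Block.Cr‖ := by
  set Z := inpPhasor ω inp 1 Block.Cr with hZ
  set U := Complex.exp (Complex.I * Z.arg) with hU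
  have hU0 : U ≠ 0 := Complex.exp_ne_zero _
  have hZU : (‖Z‖ : ℂ) * U = Z := by
    rw [hU, mul_comm Complex.I]
    exact Complex.norm_mul_exp_arg_mul_I Z
  have hZ0 : ‖Z‖ ≠ 0 := norm_ne_zero_iff.2 H.inpPhasor_Cr_ne_zero
  have hexp : ∀ n : ℕ, Complex.exp (jw ω n * (S.resetTime ω x inp : ℝ)) =
      Complex.exp (-(Complex.I * (n * (S.fr ω 1 Block.Cs).arg : ℝ))) * (U ^ n)⁻¹ := by
    intro n
    rw [← inv_inv (Complex.exp (jw ω n * (S.resetTime ω x inp : ℝ))), ← Complex.exp_neg,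
      H.cexp_resetTime n, mul_inv, Complex.exp_neg]
  -- At the reset instant the phase of `Z¹` cancels, leaving its modulus and the phase of `C_s`.
  have hfirst : (S.DeltaL ω (2 * 0 + 1) S.rho * inpPhasor ω inp (2 * 0 + 1) Block.Cr *
      Complex.exp (jw ω (2 * 0 + 1) * (S.resetTime ω x inp : ℝ))).im = ‖Z‖ * S.DeltaC1 ω := by
    rw [mul_zero, zero_add, hexp, ← hZ, pow_one]
    conv_lhs => rw [← hZU]
    have h1 : S.DeltaL ω 1 S.rho * (‖Z‖ * U) *
        (Complex.exp (-(Complex.I * ((1 : ℕ) * (S.fr ω 1 Block.Cs).arg : ℝ))) * U⁻¹) =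
        (‖Z‖ : ℂ) * (S.DeltaL ω 1 S.rho *
          Complex.exp (-(Complex.I * (S.fr ω 1 Block.Cs).arg))) := by
      rw [Nat.cast_one, one_mul]
      field_simp
    rw [h1, Complex.im_ofReal_mul, ← norm_mul_sin_arg_sub]
    rfl
  -- For `n > 1` the harmonic of `z` is itself proportional to `κ`, so the series becomes a linear
  -- equation for `κ`.
  have hterm : ∀ k : ℕ, (S.DeltaL ω (2 * (k + 1) + 1) S.rho *
      inpPhasor ω inp (2 * (k + 1) + 1) Block.Cr *
      Complex.exp (jw ω (2 * (k + 1) + 1) * (S.resetTime ω x inp : ℝ))).im =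
      κ * (S.Psi ω (2 * k + 3) * S.DeltaCn ω (2 * k + 3)) := by
    intro k
    have hodd : Odd (2 * k + 3) := ⟨k + 1, by ring⟩
    rw [show 2 * (k + 1) + 1 = 2 * k + 3 by ring, hexp, Psi_mul_DeltaCn, ← neg_mul_eq_mul_neg,
      ← neg_mul, ← Complex.im_ofReal_mul]
    have h1 := H.inpPhasor_Cr_mul hodd (by omega) hκ
    have h2 := hL _ hodd
    have h3 : inpPhasor ω inp (2 * k + 3) Block.Cr =
        -(κ * S.Lrho ω (2 * k + 3) * U ^ (2 * k + 3)) / (1 + S.Ll ω (2 * k + 3)) := by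
      rw [eq_div_iff h2, h1]
    have h4 : U ^ (2 * k + 3) ≠ 0 := pow_ne_zero _ hU0
    rw [h3]
    push_cast
    field_simp
    exact Complex.neg_im _
  have htail := (hasSum_nat_add_iff' 1).2 hsum
  simp only [Finset.range_one, Finset.sum_singleton, hterm, hfirst] at htail
  -- If `κ` were zero, all higher terms would vanish and the series would reduce to `|Z¹| Δ_c¹ = 0`.
  have hκ0 : κ ≠ 0 := by
    intro h0
    rw [h0] at htail
    simp only [zero_mul, zero_sub] at htail
    have := htail.unique hasSum_zero
    rw [neg_eq_zero] at this
    exact (mul_ne_zero hZ0 hΔ) this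
  have hser := htail.mul_left κ⁻¹
  simp only [inv_mul_cancel_left₀ hκ0] at hser
  have hPsi : S.PsiSum ω = κ⁻¹ * (κ * S.DeltaC1 ω - ‖Z‖ * S.DeltaC1 ω) := hser.tsum_eq
  have hden : 1 - S.PsiSum ω / S.DeltaC1 ω = ‖Z‖ / κ := by
    rw [hPsi]
    field_simp
    ring
  refine ⟨hser.summable, ?_, ?_⟩
  · rw [hden]
    exact div_ne_zero hZ0 hκ0
  · unfold Gam
    rw [hden]
    field_simp

end Regular

end ResetLoop

/-! ### The closed-loop describing functions -/

theorem hosidf_eq {ω R : ℝ} (hω : 0 < ω) (f : ℝ → ℝ) {n : ℕ} (hn : 1 ≤ n) :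
    hosidf ω R f n = phasor ω n f / R := by
  unfold hosidf
  rw [phasor_sin hω R hn, if_pos rfl]

end

theorem theorem2 (S : ResetLoop) (ω R : ℝ) (hω : 0 < ω) (hR : 0 < R)
    -- no direct feedthrough around the loop
    (hproper : (S.sys Block.C1).D * (S.sys Block.C3).D * (S.sys Block.P).D
      * (S.sys Block.C4).D = 0)
    (hβ : S.HBeta)
    (x : ℝ → S.Idx → ℝ) (inp : ℝ → Block → ℝ)
    (hss : S.IsSteadyState ω R x inp) (htwo : S.IsTwoReset ω x inp)
    -- the frequency responses, `Δ_q` and the division by `Δ_c¹` are meaningful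
    (hfreq : ∀ b : Block, ∀ n : ℕ, Odd n → ((S.sys b).charMat (ResetLoop.jw ω n)).det ≠ 0)
    (hq : (S.Arho * S.expAR ω + 1).det ≠ 0)
    (hΔ : S.DeltaC1 ω ≠ 0) :
    -- all the expressions below are well defined
    ((∀ n : ℕ, Odd n → 1 + S.Ll ω n ≠ 0) ∧
      Summable (fun k : ℕ => S.Psi ω (2 * k + 3) * S.DeltaCn ω (2 * k + 3)) ∧
      1 - S.PsiSum ω / S.DeltaC1 ω ≠ 0 ∧ 1 + S.Lo ω ≠ 0) ∧
    -- sensitivity `E^n / R^n`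
    (hosidf ω R (fun t => inp t Block.C1) 1 = 1 / (1 + S.Lo ω) ∧
      (∀ n : ℕ, Odd n → 1 < n →
        hosidf ω R (fun t => inp t Block.C1) n = -(S.hoFactor ω n * S.fr ω n Block.C4)) ∧
      (∀ n : ℕ, Even n → 2 ≤ n → hosidf ω R (fun t => inp t Block.C1) n = 0)) ∧
    -- complementary sensitivity `Y^n / R^n`
    ((S.fr ω 1 Block.C4 ≠ 0 →
        hosidf ω R (fun t => inp t Block.C4) 1 =
          S.Lo ω / (S.fr ω 1 Block.C4 * (1 + S.Lo ω))) ∧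
      (∀ n : ℕ, Odd n → 1 < n →
        hosidf ω R (fun t => inp t Block.C4) n = S.hoFactor ω n) ∧
      (∀ n : ℕ, Even n → 2 ≤ n → hosidf ω R (fun t => inp t Block.C4) n = 0)) ∧
    -- control sensitivity `U^n / R^n`
    ((S.fr ω 1 Block.C4 ≠ 0 → S.fr ω 1 Block.P ≠ 0 →
        hosidf ω R (fun t => inp t Block.P) 1 =
          S.Lo ω / (S.fr ω 1 Block.C4 * S.fr ω 1 Block.P * (1 + S.Lo ω))) ∧
      (∀ n : ℕ, Odd n → 1 < n → S.fr ω n Block.P ≠ 0 →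
        hosidf ω R (fun t => inp t Block.P) n = S.hoFactor ω n / S.fr ω n Block.P) ∧
      (∀ n : ℕ, Even n → 2 ≤ n → hosidf ω R (fun t => inp t Block.P) n = 0)) := by
  have H : S.Regular ω R x inp := ⟨hω, hproper, hss, htwo,
    hss.add_half_period hω hproper hβ htwo, hss.inp_add_half_period hω hproper hβ htwo, hfreq⟩
  have hL : ∀ n : ℕ, Odd n → 1 + S.Ll ω n ≠ 0 := by
    obtain ⟨Acl, czs, β, p, hbl, hA, -, -⟩ := hβ
    exact fun n hn => ResetLoop.one_add_Ll_ne_zero hproper hbl hA fun b => hfreq b n hn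
  obtain ⟨κ, hκ, hsum⟩ := H.exists_resetAmplitude hq hΔ
  obtain ⟨hsummable, hden, hκΓ⟩ := H.resetAmplitude_eq hΔ hL hκ hsum
  have hZ0 := H.inpPhasor_Cr_ne_zero
  have hR0 : (R : ℂ) ≠ 0 := by exact_mod_cast hR.ne'
  -- For the fundamental, the reset term is thus `Γ C_ρ¹ Z¹`: the resets act as a linear gain in
  -- parallel with `C_l` and `C_2`.
  have hκU : (κ : ℂ) * Complex.exp
      (Complex.I * (ResetLoop.inpPhasor ω inp 1 Block.Cr).arg) =
      S.Gam ω * ResetLoop.inpPhasor ω inp 1 Block.Cr := by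
    rw [hκΓ, mul_comm Complex.I]
    push_cast
    rw [mul_assoc, Complex.norm_mul_exp_arg_mul_I]
  -- first harmonic
  obtain ⟨hz, hu, hy, he⟩ := H.loop_equations odd_one hκ
  rw [if_pos rfl] at he
  rw [pow_one] at hu
  have hLo : S.Lo ω = (S.fr ω 1 Block.Cr + S.fr ω 1 Block.C2 + S.Gam ω * S.Crho ω 1) *
      S.fr ω 1 Block.C3 * S.fr ω 1 Block.P * S.fr ω 1 Block.C4 * S.fr ω 1 Block.C1 := by
    unfold ResetLoop.Lo ResetLoop.Ln ResetLoop.Lrho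
    rw [if_pos rfl]
    ring
  have hE : ResetLoop.inpPhasor ω inp 1 Block.C1 * (1 + S.Lo ω) = R := by
    rw [hLo]
    linear_combination he - S.fr ω 1 Block.C4 * hy -
      S.fr ω 1 Block.C4 * S.fr ω 1 Block.P * hu -
      S.fr ω 1 Block.C4 * S.fr ω 1 Block.P * S.fr ω 1 Block.C3 * S.Crho ω 1 * hκU -
      S.fr ω 1 Block.C4 * S.fr ω 1 Block.P * S.fr ω 1 Block.C3 *
        (S.fr ω 1 Block.Cr + S.fr ω 1 Block.C2 + S.Gam ω * S.Crho ω 1) * hz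
  have hLo1 : 1 + S.Lo ω ≠ 0 := by
    intro h0
    rw [h0, mul_zero] at hE
    exact hR0 hE.symm
  have hE' : ResetLoop.inpPhasor ω inp 1 Block.C1 = R / (1 + S.Lo ω) := by
    rw [eq_div_iff hLo1, hE]
  have hY' : S.fr ω 1 Block.C4 ≠ 0 → ResetLoop.inpPhasor ω inp 1 Block.C4 =
      R * (S.Lo ω / (S.fr ω 1 Block.C4 * (1 + S.Lo ω))) := by
    intro hC4
    rw [hE'] at he
    field_simp at he ⊢
    linear_combination he
  -- higher harmonics
  have hS1 : Complex.exp (Complex.I * (ResetLoop.inpPhasor ω inp 1 Block.Cr).arg) =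
      Complex.exp (Complex.I * (S.fr ω 1 Block.C1).arg) *
        Complex.exp (Complex.I * (S.S1 ω).arg) ∧
      ‖ResetLoop.inpPhasor ω inp 1 Block.Cr‖ = ‖S.fr ω 1 Block.C1‖ * (R * ‖S.S1 ω‖) := by
    have h1 : ResetLoop.inpPhasor ω inp 1 Block.Cr = S.fr ω 1 Block.C1 * (R * S.S1 ω) := by
      rw [hz, hE']
      unfold ResetLoop.S1
      ring
    -- The phase of `Z¹` may be split because both factors are nonzero, which `Z¹ ≠ 0` forces.
    have h2 : S.fr ω 1 Block.C1 ≠ 0 := by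
      intro h0
      rw [h1, h0, zero_mul] at hZ0
      exact hZ0 rfl
    have h3 : (R : ℂ) * S.S1 ω ≠ 0 := by
      intro h0
      rw [h1, h0, mul_zero] at hZ0
      exact hZ0 rfl
    refine ⟨?_, ?_⟩
    · rw [h1, cexp_I_arg_mul h2 h3, Complex.arg_real_mul _ hR]
    · rw [h1, norm_mul, norm_mul, Complex.norm_real, Real.norm_of_nonneg hR.le]
  have hYn : ∀ n : ℕ, Odd n → 1 < n →
      ResetLoop.inpPhasor ω inp n Block.C4 = R * S.hoFactor ω n := by
    intro n hn hn1
    obtain ⟨hzn, hun, hyn, hen⟩ := H.loop_equations hn hκ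
    rw [if_neg hn1.ne'] at hen
    have hLn := hL n hn
    have h1 : ResetLoop.inpPhasor ω inp n Block.C4 * (1 + S.Ll ω n) =
        S.fr ω n Block.P * S.fr ω n Block.C3 * (κ * S.Crho ω n * Complex.exp
          (Complex.I * (ResetLoop.inpPhasor ω inp 1 Block.Cr).arg) ^ n) := by
      unfold ResetLoop.Ll
      linear_combination hyn + S.fr ω n Block.P * hun +
        S.fr ω n Block.P * S.fr ω n Block.C3 * (S.fr ω n Block.Cr + S.fr ω n Block.C2) * hzn +
        S.fr ω n Block.P * S.fr ω n Block.C3 * (S.fr ω n Block.Cr + S.fr ω n Block.C2) *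
          S.fr ω n Block.C1 * hen
    -- The factor `e^{j(n-1)∠C_1}` raises the phase of `C_1` to its `n`th multiple while keeping the
    -- modulus to the first power, matching `κ e^{jn∠Z¹}`.
    have h2 : S.Ln ω n = ‖S.fr ω 1 Block.C1‖ *
        Complex.exp (Complex.I * (S.fr ω 1 Block.C1).arg) ^ n *
        S.Crho ω n * S.fr ω n Block.C3 * S.fr ω n Block.P := by
      unfold ResetLoop.Ln
      rw [if_neg hn1.ne', if_pos hn]
      have h3 := Complex.norm_mul_exp_arg_mul_I (S.fr ω 1 Block.C1)
      have h4 : Complex.exp (Complex.I * (S.fr ω 1 Block.C1).arg) ^ n =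
          Complex.exp ((S.fr ω 1 Block.C1).arg * Complex.I) *
            Complex.exp (Complex.I * ((((n : ℝ) - 1) * (S.fr ω 1 Block.C1).arg : ℝ) : ℂ)) := by
        rw [← Complex.exp_nat_mul, ← Complex.exp_add]
        push_cast
        ring_nf
      rw [h4]
      linear_combination
        -(Complex.exp (Complex.I * ((((n : ℝ) - 1) * (S.fr ω 1 Block.C1).arg : ℝ) : ℂ)) *
          S.Crho ω n * S.fr ω n Block.C3 * S.fr ω n Block.P) * h3
    rw [← mul_left_inj' hLn, h1]
    unfold ResetLoop.hoFactor ResetLoop.Sl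
    rw [h2, hκΓ, hS1.1, hS1.2, cexp_nat_mul_I, mul_pow]
    push_cast
    field_simp
  have heven : ∀ b : Block, ∀ n : ℕ, Even n → 2 ≤ n →
      hosidf ω R (fun t => inp t b) n = 0 := by
    intro b n hn hn2
    rw [hosidf_eq hω _ (by omega)]
    change ResetLoop.inpPhasor ω inp n b / R = 0
    rw [H.inpPhasor_of_even hn, zero_div]
  refine ⟨⟨hL, hsummable, hden, hLo1⟩, ⟨?_, ?_, heven _⟩, ⟨?_, ?_, heven _⟩, ⟨?_, ?_, heven _⟩⟩
  · rw [hosidf_eq hω _ le_rfl]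
    change ResetLoop.inpPhasor ω inp 1 Block.C1 / R = _
    rw [hE']
    field_simp
  · intro n hn hn1
    rw [hosidf_eq hω _ hn1.le]
    change ResetLoop.inpPhasor ω inp n Block.C1 / R = _
    have hen := (H.loop_equations hn hκ).2.2.2
    rw [if_neg hn1.ne', hYn n hn hn1] at hen
    rw [div_eq_iff hR0]
    linear_combination hen
  · intro hC4
    rw [hosidf_eq hω _ le_rfl]
    change ResetLoop.inpPhasor ω inp 1 Block.C4 / R = _
    rw [hY' hC4, mul_div_cancel_left₀ _ hR0]
  · intro n hn hn1
    rw [hosidf_eq hω _ hn1.le]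
    change ResetLoop.inpPhasor ω inp n Block.C4 / R = _
    rw [hYn n hn hn1, mul_div_cancel_left₀ _ hR0]
  · intro hC4 hP
    rw [hosidf_eq hω _ le_rfl]
    change ResetLoop.inpPhasor ω inp 1 Block.P / R = _
    have h1 := hY' hC4
    rw [hy] at h1
    rw [div_eq_iff hR0, ← mul_right_inj' hP, h1]
    field_simp
  · intro n hn hn1 hP
    rw [hosidf_eq hω _ hn1.le]
    change ResetLoop.inpPhasor ω inp n Block.P / R = _
    have h1 := hYn n hn hn1
    rw [(H.loop_equations hn hκ).2.2.1] at h1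
    rw [div_eq_iff hR0, ← mul_right_inj' hP, h1]
    field_simp
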